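/- For $t>0$ and locally integrable $f:\mathbb R\to\mathbb R$ let \[ S(t)f(x)=\frac{e^{-t/2}}{2}\int_{-t}^{t} I_0\Big(\tfrac{\sqrt{t^2-y^2}}{2}\Big)f(x-y)\,dy ,\qquad x\in\mathbb R, \] where $I_0(z)=\sum_{k\ge 0}\frac{(z/2)^{2k}}{(k!)^2}$ is the modified Bessel function of the first kind of order $0$. Let $\phi\in W^{1,1}\cap W^{1,\infty}(\mathbb R;(0,\infty))$ with weak derivative $\dot\phi$. Assume that there is a constant $C$ such that, for almost every $x\in\mathbb R$, \[ \phi(x)\le C\inf_{y\in(x-1,x+1)}\phi(y),\qquad \phi(x)\le C\inf_{|y|<2|x|}\phi(y),\qquad |\dot\phi(x)|\le C\phi(x), \] where the infima are essential infima, and that for every $\delta>0$ there is a constant $C_\delta>0$ such that $e^{-\delta|x|}\le C_\delta\,\phi(x)$ for almost every $x\in\mathbb R$. Then $\partial_t S(t)\phi(x)$ exists for all $t>0$ and $x\in\mathbb R$; for each $x$ it is locally Lipschitz in $t\in(0,\infty)$; and for each $t>0$ the second derivative $\partial_t^2S(t)\phi(x)$ exists for almost every $x$. Moreover, for every $\sigma\in(1/2,1)$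 there is a constant $C_\sigma>0$, depending only on $\sigma$ and $\phi$, such that \[ |\partial_t^2 S(t)\phi(x)|\le C_\sigma\, t^{-4(1-\sigma)}\,S(t)\phi(x) \] for all $t\ge 2$ and all $x\in\mathbb R$ at which $\partial_t^2 S(t)\phi(x)$ exists. -/

import Mathlib

open MeasureTheory Set Filter Topology

/-- The modified Bessel function of the first kind of order zero,
`I₀(z) = ∑ₖ (z/2)^(2k) / (k!)²` (the series converges for every real `z`). -/
noncomputable def besselI0 (z : ℝ) : ℝ :=
  ∑' k : ℕ, (z / 2) ^ (2 * k) / ((Nat.factorial k : ℝ)) ^ 2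

/-- The solution operator of the one-dimensional linear damped wave equation,
`S(t) f(x) = (e^{-t/2} / 2) ∫_{-t}^{t} I₀(√(t² - y²) / 2) f(x - y) dy`, for `t ≥ 0` and
`f` locally integrable. -/
noncomputable def dampedWaveS (t : ℝ) (f : ℝ → ℝ) (x : ℝ) : ℝ :=
  Real.exp (-t / 2) / 2 *
    ∫ y in (-t)..t, besselI0 (Real.sqrt (t ^ 2 - y ^ 2) / 2) * f (x - y)

/-- `g` is a weak (distributional) derivative of `f` on the real line. -/
def HasWeakDeriv (f g : ℝ → ℝ) : Prop :=
  LocallyIntegrable f volume ∧ LocallyIntegrable g volume ∧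
    ∀ θ : ℝ → ℝ, ContDiff ℝ (⊤ : ℕ∞) θ → HasCompactSupport θ →
      ∫ x, f x * deriv θ x = -∫ x, g x * θ x

/-- `f` belongs to `W^{1,1} ∩ W^{1,∞}` of the real line, with weak derivative `g`. -/
structure MemW11W1Infty (f g : ℝ → ℝ) : Prop where
  hasWeakDeriv : HasWeakDeriv f g
  memLp_one : MemLp f 1 volume
  memLp_top : MemLp f ⊤ volume
  deriv_memLp_one : MemLp g 1 volume
  deriv_memLp_top : MemLp g ⊤ volume

/-!
Write `B_n(v) = ∑ₖ vᵏ / (k! (k + n)!)`, so that `I₀(√(t² - y²) / 2) = B₀((t² - y²) / 16)` is entire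
in `t² - y²`. The function `φ` has a Lipschitz representative `ψ`
(`MemW11W1Infty.exists_lipschitzWith`, by the du Bois-Reymond lemma), and by continuity the
essential bounds on `φ` hold at every point for `ψ` (`IsDoublingWeight`).
The Leibniz rule on `(-t, t)` gives
`∂ₜ S(t)φ(x) = (e^{-t/2} / 2) (ψ(x - t) + ψ(x + t) + Q(t))` with `Q` continuously differentiable,
which yields existence and local Lipschitz continuity of the first derivative, and almost everywhere
existence of the second by Rademacher's theorem.

Where `∂ₜ² S(t)φ(x)` exists, it is the integral of `ψ(x - y)` against `∂ₜ²` of the wave kernel, plus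
terms of size at most a constant times `e^{-t/2} (1 + t) (ψ(x - t) + ψ(x + t))`
(`exists_hasDerivAt_and_eq_of_hasDerivAt_deriv`). For `|y| ≤ t^σ / 2` the expansion
`I₁(z) / I₀(z) = 1 - 1 / (2 z) + O(z⁻²)`, obtained by comparison in the Riccati-type equation for
`I₁ - g I₀` (`abs_besselClifford_one_sub_le`), shows that `∂ₜ²` gains a factor `t⁻² + (y² / t²)²`,
which is at most `2 t^{-4(1-σ)}`. For `|y| > t^σ / 2` the kernel is at most a power of `t` times
`e^{-t^{2σ-1}/16}`. The condition `φ(x) ≤ C φ(y)` for `|y| < 2 |x|` is a doubling condition, so that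
`ψ(x - y) ≤ A tᵖ ψ(x)` for `|y| ≤ t` (`IsDoublingWeight.exists_le_pow_mul`), while
`ψ(x) ≤ 8 C t S(t)φ(x)` because the kernel is at least `1 / (8 t)` near the origin. The stretched
exponential absorbs all these powers.
-/

/-! ### The Bessel–Clifford functions -/

/-- The Bessel–Clifford function `v ↦ ∑ₖ vᵏ / (k! (k + n)!)` of order `n`, an entire function with
`I₀(z) = besselClifford 0 (z² / 4)` and `I₁(z) = (z / 2) * besselClifford 1 (z² / 4)`. -/
noncomputable def besselClifford (n : ℕ) (v : ℝ) : ℝ :=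
  ∑' k : ℕ, v ^ k / ((Nat.factorial k : ℝ) * (Nat.factorial (k + n) : ℝ))

theorem one_le_cast_factorial (n : ℕ) : (1 : ℝ) ≤ (Nat.factorial n : ℝ) := by
  exact_mod_cast Nat.factorial_pos n

theorem summable_besselClifford (n : ℕ) (v : ℝ) :
    Summable fun k : ℕ => v ^ k / ((Nat.factorial k : ℝ) * (Nat.factorial (k + n) : ℝ)) := by
  refine Summable.of_norm_bounded (Real.summable_pow_div_factorial |v|) fun k => ?_
  have h1 := one_le_cast_factorial k
  have h2 := one_le_cast_factorial (k + n)
  rw [Real.norm_eq_abs, abs_div, abs_pow, abs_of_pos (by positivity : (0 : ℝ) < _ * _)]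
  gcongr
  nlinarith

theorem hasDerivAt_besselClifford (n : ℕ) (v : ℝ) :
    HasDerivAt (besselClifford n) (besselClifford (n + 1) v) v := by
  set R : ℝ := |v| + 1
  have hR : 0 < R := by positivity
  let u : ℕ → ℝ := fun k => k * R ^ (k - 1) / (Nat.factorial k : ℝ)
  have hu : Summable u := by
    rw [← summable_nat_add_iff 1]
    refine (Real.summable_pow_div_factorial R).congr fun k => ?_
    have := one_le_cast_factorial k
    simp only [u, Nat.add_sub_cancel, Nat.factorial_succ]
    push_cast
    field_simp
  have hv : v ∈ Metric.ball (0 : ℝ) R := by simp [R]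
  have key := hasDerivAt_tsum_of_isPreconnected (𝕜 := ℝ) (F := ℝ) (y₀ := v) (y := v)
    (g := fun k v => v ^ k / ((Nat.factorial k : ℝ) * (Nat.factorial (k + n) : ℝ)))
    (g' := fun k v => k * v ^ (k - 1) / ((Nat.factorial k : ℝ) * (Nat.factorial (k + n) : ℝ)))
    hu Metric.isOpen_ball (convex_ball (0 : ℝ) R).isPreconnected
    (fun k y _ => (hasDerivAt_pow k y).div_const _) ?_ hv (summable_besselClifford n v) hv
  · have hg : Summable fun k : ℕ =>
        k * v ^ (k - 1) / ((Nat.factorial k : ℝ) * (Nat.factorial (k + n) : ℝ)) := by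
      rw [← summable_nat_add_iff 1]
      refine (summable_besselClifford (n + 1) v).congr fun k => ?_
      have := one_le_cast_factorial k
      have := one_le_cast_factorial (k + (n + 1))
      rw [Nat.add_sub_cancel, Nat.factorial_succ, add_right_comm k 1 n, add_assoc k n 1]
      push_cast
      field_simp
    rw [hg.tsum_eq_zero_add] at key
    convert! key using 1
    rw [besselClifford]
    simp only [Nat.cast_zero, zero_mul, zero_div, zero_add]
    refine tsum_congr fun k => ?_
    have := one_le_cast_factorial k
    have := one_le_cast_factorial (k + (n + 1))
    rw [Nat.add_sub_cancel, Nat.factorial_succ, add_right_comm k 1 n, add_assoc k n 1]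
    push_cast
    field_simp
  · intro k y hy
    have h1 := one_le_cast_factorial k
    have h2 := one_le_cast_factorial (k + n)
    have hy' : |y| ≤ R := by simpa using (mem_ball_zero_iff.1 hy).le
    rw [Real.norm_eq_abs, abs_div, abs_mul, abs_pow, Nat.abs_cast,
      abs_of_pos (by positivity : (0 : ℝ) < _ * _)]
    simp only [u]
    gcongr
    nlinarith

theorem continuous_besselClifford (n : ℕ) : Continuous (besselClifford n) :=
  continuous_iff_continuousAt.2 fun v => (hasDerivAt_besselClifford n v).continuousAt

theorem besselClifford_recurrence (n : ℕ) (v : ℝ) :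
    v * besselClifford (n + 2) v + (n + 1) * besselClifford (n + 1) v = besselClifford n v := by
  have hs : ∀ k : ℕ, v * (v ^ k / ((Nat.factorial k : ℝ) * (Nat.factorial (k + (n + 2)) : ℝ))) =
      ((k + 1 : ℕ) : ℝ) * v ^ (k + 1) /
        ((Nat.factorial (k + 1) : ℝ) * (Nat.factorial (k + 1 + (n + 1)) : ℝ)) := fun k => by
    have := one_le_cast_factorial k
    have := one_le_cast_factorial (k + (n + 2))
    rw [show k + 1 + (n + 1) = k + (n + 2) by ring, Nat.factorial_succ k]
    push_cast
    field_simp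
    ring
  have hsum : Summable fun k : ℕ => (k : ℝ) * v ^ k /
      ((Nat.factorial k : ℝ) * (Nat.factorial (k + (n + 1)) : ℝ)) := by
    rw [← summable_nat_add_iff 1]
    exact ((summable_besselClifford (n + 2) v).mul_left v).congr hs
  have h1 : v * besselClifford (n + 2) v = ∑' k : ℕ, (k : ℝ) * v ^ k /
      ((Nat.factorial k : ℝ) * (Nat.factorial (k + (n + 1)) : ℝ)) := by
    rw [hsum.tsum_eq_zero_add, besselClifford, ← tsum_mul_left, tsum_congr hs]
    simp
  rw [h1, besselClifford, ← tsum_mul_left,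
    ← hsum.tsum_add ((summable_besselClifford (n + 1) v).mul_left _), besselClifford]
  refine tsum_congr fun k => ?_
  have := one_le_cast_factorial k
  have := one_le_cast_factorial (k + n)
  rw [← add_assoc, Nat.factorial_succ]
  push_cast
  field_simp
  ring

theorem besselClifford_pos (n : ℕ) {v : ℝ} (hv : 0 ≤ v) : 0 < besselClifford n v :=
  (summable_besselClifford n v).tsum_pos (fun k => by positivity) 0 (by simp; positivity)

theorem besselClifford_succ_le (n : ℕ) {v : ℝ} (hv : 0 ≤ v) :
    besselClifford (n + 1) v ≤ besselClifford n v := by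
  refine (summable_besselClifford _ v).tsum_le_tsum (fun k => ?_) (summable_besselClifford _ v)
  gcongr
  omega

theorem besselClifford_zero_le_exp {z : ℝ} (hz : 0 ≤ z) :
    besselClifford 0 (z ^ 2 / 4) ≤ Real.exp z := by
  have hcosh : besselClifford 0 (z ^ 2 / 4) ≤ Real.cosh z := by
    rw [Real.cosh_eq_tsum]
    refine (summable_besselClifford _ _).tsum_le_tsum (fun k => ?_) (Real.hasSum_cosh z).summable
    rw [div_pow, ← pow_mul, div_div]
    gcongr
    -- the central binomial coefficient `(2k)! / (k!)²` is at most `4ᵏ`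
    have h := Nat.choose_le_two_pow (2 * k) k
    have h2 := Nat.choose_mul_factorial_mul_factorial (show k ≤ 2 * k by omega)
    rw [show 2 * k - k = k by omega] at h2
    rw [pow_mul] at h
    norm_num at h
    have h3 : Nat.factorial (2 * k) ≤ 4 ^ k * (Nat.factorial k * Nat.factorial (k + 0)) := by
      rw [← h2, mul_assoc]
      exact Nat.mul_le_mul_right _ h
    exact_mod_cast h3
  refine hcosh.trans ?_
  rw [Real.cosh_eq]
  have : Real.exp (-z) ≤ Real.exp z := Real.exp_le_exp.2 (by linarith)
  linarith

theorem sinh_le_mul_besselClifford_zero {z : ℝ} (hz : 0 ≤ z) :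
    Real.sinh z ≤ z * besselClifford 0 (z ^ 2 / 4) := by
  rw [Real.sinh_eq_tsum, besselClifford, ← tsum_mul_left]
  refine (Real.hasSum_sinh z).summable.tsum_le_tsum (fun k => ?_)
    ((summable_besselClifford _ _).mul_left _)
  rw [div_pow, ← pow_mul, div_div, mul_div_assoc', ← pow_succ']
  gcongr
  -- the central binomial coefficient `(2k)! / (k!)²` is at least `4ᵏ / (2k + 1)`
  have h := Nat.four_pow_le_two_mul_add_one_mul_central_binom k
  have h2 := Nat.choose_mul_factorial_mul_factorial (show k ≤ 2 * k by omega)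
  rw [show 2 * k - k = k by omega] at h2
  have h3 : 4 ^ k * (Nat.factorial k * Nat.factorial (k + 0)) ≤ Nat.factorial (2 * k + 1) := by
    rw [Nat.factorial_succ, ← h2, add_zero, mul_assoc (Nat.choose _ _), ← mul_assoc (2 * k + 1)]
    exact Nat.mul_le_mul_right _ h
  exact_mod_cast h3

theorem besselI0_eq (z : ℝ) : besselI0 z = besselClifford 0 (z ^ 2 / 4) := by
  refine tsum_congr fun k => ?_
  rw [pow_mul, add_zero, ← sq, div_pow]
  norm_num

/-! ### The second order asymptotics of `I₁ / I₀` -/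

/-- A solution of the differential inequality `D' + P' D ≥ 0` that starts nonnegative stays
nonnegative, because `D e^P` is nondecreasing. -/
theorem nonneg_of_deriv_add_mul_nonneg {D D' P P' : ℝ → ℝ} {a x : ℝ} (hx : a ≤ x)
    (hD : ∀ y, a ≤ y → HasDerivAt D (D' y) y) (hP : ∀ y, a ≤ y → HasDerivAt P (P' y) y)
    (h : ∀ y, a ≤ y → 0 ≤ D' y + P' y * D y) (ha : 0 ≤ D a) : 0 ≤ D x := by
  have hd : ∀ y, a ≤ y → HasDerivAt (fun y => D y * Real.exp (P y))
      (D' y * Real.exp (P y) + D y * (Real.exp (P y) * P' y)) y :=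
    fun y hy => (hD y hy).mul (hP y hy).exp
  have hmono : MonotoneOn (fun y => D y * Real.exp (P y)) (Ici a) := by
    refine monotoneOn_of_deriv_nonneg (convex_Ici a)
      (fun y hy => (hd y hy).continuousAt.continuousWithinAt) (fun y hy => ?_) fun y hy => ?_
    · rw [interior_Ici] at hy
      exact (hd y hy.le).differentiableAt.differentiableWithinAt
    · rw [interior_Ici] at hy
      rw [(hd y hy.le).deriv]
      have := mul_nonneg (h y hy.le) (Real.exp_pos (P y)).le
      linarith
  have h1 := hmono (mem_Ici.2 le_rfl) (mem_Ici.2 hx) hx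
  have h2 : 0 ≤ D x * Real.exp (P x) := (mul_nonneg ha (Real.exp_pos _).le).trans h1
  exact nonneg_of_mul_nonneg_left h2 (Real.exp_pos _)

/-- The relation `I₀' = I₁`. -/
theorem hasDerivAt_besselClifford_zero_sq (z : ℝ) :
    HasDerivAt (fun z : ℝ => besselClifford 0 (z ^ 2 / 4))
      (z / 2 * besselClifford 1 (z ^ 2 / 4)) z := by
  have h1 : HasDerivAt (fun z : ℝ => z ^ 2 / 4) (z / 2) z := by
    convert! (hasDerivAt_pow 2 z).div_const 4 using 1
    push_cast
    ring
  convert! (hasDerivAt_besselClifford 0 (z ^ 2 / 4)).comp z h1 using 1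
  ring

/-- The relation `I₁' = I₀ - I₁ / z`. -/
theorem hasDerivAt_besselClifford_one_sq {z : ℝ} (hz : z ≠ 0) :
    HasDerivAt (fun z : ℝ => z / 2 * besselClifford 1 (z ^ 2 / 4))
      (besselClifford 0 (z ^ 2 / 4) - z / 2 * besselClifford 1 (z ^ 2 / 4) / z) z := by
  have h1 : HasDerivAt (fun z : ℝ => z ^ 2 / 4) (z / 2) z := by
    convert! (hasDerivAt_pow 2 z).div_const 4 using 1
    push_cast
    ring
  have h2 : HasDerivAt (fun z : ℝ => z / 2) (1 / 2) z := (hasDerivAt_id z).div_const 2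
  convert! h2.mul ((hasDerivAt_besselClifford 1 (z ^ 2 / 4)).comp z h1) using 1
  have := besselClifford_recurrence 0 (z ^ 2 / 4)
  simp only [zero_add, Nat.cast_zero, one_mul] at this
  rw [← this]
  simp only [Function.comp]
  field_simp
  ring

/-- `I₁(z) = (1 - 1 / (2 z) + O(z⁻²)) I₀(z)`. With `g = 1 - 1 / (2 z) - a / z²`, the difference
`D = I₁ - g I₀` satisfies `D' + (1 / z + g) D = (1 - g / z - g² - g') I₀`, and the right side has a
constant sign on `[2, ∞)` for `a = 3` and for `a = -1`. -/
theorem abs_besselClifford_one_sub_le {z : ℝ} (hz : 2 ≤ z) :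
    |z / 2 * besselClifford 1 (z ^ 2 / 4) - (1 - 1 / (2 * z)) * besselClifford 0 (z ^ 2 / 4)| ≤
      3 / z ^ 2 * besselClifford 0 (z ^ 2 / 4) := by
  set F : ℝ → ℝ := fun z => besselClifford 0 (z ^ 2 / 4) with hF
  set H : ℝ → ℝ := fun z => z / 2 * besselClifford 1 (z ^ 2 / 4) with hH
  have hFpos : ∀ y, 0 < F y := fun y => besselClifford_pos 0 (by positivity)
  have hFd : ∀ y, HasDerivAt F (H y) y := hasDerivAt_besselClifford_zero_sq
  have hHd : ∀ y, y ≠ 0 → HasDerivAt H (F y - H y / y) y :=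
    fun y hy => hasDerivAt_besselClifford_one_sq hy
  have hg : ∀ a y : ℝ, y ≠ 0 → HasDerivAt (fun y : ℝ => 1 - 1 / (2 * y) - a / y ^ 2)
      (1 / (2 * y ^ 2) + 2 * a / y ^ 3) y := fun a y hy => by
    have h1 : HasDerivAt (fun y : ℝ => 1 - 2⁻¹ * y⁻¹ - a * (y⁻¹ * y⁻¹))
        (0 - 2⁻¹ * (-(y ^ 2)⁻¹) - a * (-(y ^ 2)⁻¹ * y⁻¹ + y⁻¹ * -(y ^ 2)⁻¹)) y :=
      ((hasDerivAt_const y (1 : ℝ)).sub ((hasDerivAt_inv hy).const_mul _)).sub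
        (((hasDerivAt_inv hy).mul (hasDerivAt_inv hy)).const_mul a)
    convert! h1 using 1
    · ext y
      rw [one_div, mul_inv, div_eq_mul_inv, sq, mul_inv]
    · field_simp
      ring
  have hP : ∀ a y : ℝ, 0 < y →
      HasDerivAt (fun y : ℝ => y + 1 / 2 * Real.log y + a * y⁻¹)
        (1 / y + (1 - 1 / (2 * y) - a / y ^ 2)) y := fun a y hy => by
    convert! ((hasDerivAt_id y).add ((Real.hasDerivAt_log hy.ne').const_mul (1 / 2))).add
      ((hasDerivAt_inv hy.ne').const_mul a) using 1
    field_simp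
    ring
  have hD : ∀ a y : ℝ, y ≠ 0 → HasDerivAt
      (fun y : ℝ => H y - (1 - 1 / (2 * y) - a / y ^ 2) * F y)
      (F y - H y / y - ((1 / (2 * y ^ 2) + 2 * a / y ^ 3) * F y +
        (1 - 1 / (2 * y) - a / y ^ 2) * H y)) y :=
    fun a y hy => (hHd y hy).sub ((hg a y hy).mul (hFd y))
  have hid : ∀ a y : ℝ, y ≠ 0 → F y - H y / y - ((1 / (2 * y ^ 2) + 2 * a / y ^ 3) * F y +
        (1 - 1 / (2 * y) - a / y ^ 2) * H y) + (1 / y + (1 - 1 / (2 * y) - a / y ^ 2)) *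
        (H y - (1 - 1 / (2 * y) - a / y ^ 2) * F y) =
      ((2 * a - 1 / 4) * y ^ 2 - 2 * a * y - a ^ 2) / y ^ 4 * F y := fun a y hy => by
    field_simp
    ring
  have hz0 : (0 : ℝ) < z := by linarith
  have hlow : 0 ≤ H z - (1 - 1 / (2 * z) - 3 / z ^ 2) * F z := by
    refine nonneg_of_deriv_add_mul_nonneg
      (D := fun y => H y - (1 - 1 / (2 * y) - 3 / y ^ 2) * F y) hz
      (fun y hy => hD 3 y (by linarith)) (fun y hy => hP 3 y (by linarith))
      (fun y hy => ?_) ?_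
    · have := hid 3 y (by linarith)
      rw [this]
      refine mul_nonneg (div_nonneg ?_ (by positivity)) (hFpos y).le
      nlinarith
    · have : 0 < H 2 := by
        have := besselClifford_pos 1 (show (0 : ℝ) ≤ 2 ^ 2 / 4 by norm_num)
        simp only [H]
        linarith
      norm_num
      exact this.le
  have hup : 0 ≤ -(H z - (1 - 1 / (2 * z) - (-1) / z ^ 2) * F z) := by
    refine nonneg_of_deriv_add_mul_nonneg
      (D := fun y => -(H y - (1 - 1 / (2 * y) - (-1) / y ^ 2) * F y)) hz
      (fun y hy => (hD (-1) y (by linarith)).neg) (fun y hy => hP (-1) y (by linarith))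
      (fun y hy => ?_) ?_
    · have h1 := hid (-1) y (by linarith)
      have h2 : 0 ≤ -(((2 * (-1) - 1 / 4) * y ^ 2 - 2 * (-1) * y - (-1) ^ 2) / y ^ 4 * F y) := by
        rw [← neg_mul, ← neg_div]
        refine mul_nonneg (div_nonneg ?_ (by positivity)) (hFpos y).le
        nlinarith
      rw [← h1] at h2
      linarith
    · have := besselClifford_succ_le 0 (show (0 : ℝ) ≤ 2 ^ 2 / 4 by norm_num)
      simp only [H, F]
      norm_num at this ⊢
      linarith
  have hFz := hFpos z
  have h1 : F z / z ^ 2 ≤ 3 / z ^ 2 * F z := by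
    rw [div_mul_eq_mul_div]
    gcongr
    linarith
  rw [abs_le]
  constructor
  · have : (1 - 1 / (2 * z) - 3 / z ^ 2) * F z =
        (1 - 1 / (2 * z)) * F z - 3 / z ^ 2 * F z := by ring
    simp only [F, H] at *
    linarith
  · have : (1 - 1 / (2 * z) - (-1) / z ^ 2) * F z =
        (1 - 1 / (2 * z)) * F z + F z / z ^ 2 := by ring
    simp only [F, H] at *
    linarith

/-! ### Pointwise bounds for the kernel of the second time derivative -/

/-- With `v = (t² - y²) / 16`, the second `t`-derivative of `e^{-t/2} I₀(√(t² - y²) / 2)` is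
`e^{-t/2} * secondTimeKernel t v`. -/
noncomputable def secondTimeKernel (t v : ℝ) : ℝ :=
  besselClifford 0 v / 4 - t / 8 * besselClifford 1 v +
    (besselClifford 1 v / 8 + t ^ 2 / 64 * besselClifford 2 v)

theorem abs_secondTimeKernel_le {t v : ℝ} (ht : 2 ≤ t) (hv : 0 ≤ v) :
    |secondTimeKernel t v| ≤ t ^ 2 * besselClifford 0 v := by
  have h0 := besselClifford_pos 0 hv
  have h1 := besselClifford_pos 1 hv
  have h2 := besselClifford_pos 2 hv
  have h01 := besselClifford_succ_le 0 hv
  have h12 := besselClifford_succ_le 1 hv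
  norm_num at h01 h12
  have a1 : 0 ≤ t * (besselClifford 0 v - besselClifford 1 v) :=
    mul_nonneg (by linarith) (by linarith)
  have a2 : 0 ≤ t * besselClifford 1 v := mul_nonneg (by linarith) h1.le
  have a3 : 0 ≤ t ^ 2 * (besselClifford 0 v - besselClifford 2 v) :=
    mul_nonneg (by positivity) (by linarith)
  have a4 : 0 ≤ t ^ 2 * besselClifford 2 v := by positivity
  have a5 : 0 ≤ (t ^ 2 - 2 * t) * besselClifford 0 v := mul_nonneg (by nlinarith) h0.le
  have a6 : 0 ≤ (t ^ 2 - 4) * besselClifford 0 v := mul_nonneg (by nlinarith) h0.le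
  rw [secondTimeKernel, abs_le]
  constructor <;> nlinarith

theorem abs_quadratic_remainder_le {δ w q r : ℝ} (hw0 : 0 ≤ w) (hwr : w ≤ 2 * r) (hδ0 : 0 ≤ δ)
    (hδq : δ ≤ 2 * q) (hδ1 : δ ≤ 1) :
    |δ ^ 2 / 4 - w / 2 * (δ * (3 + 2 * δ)) - w ^ 2 / 2 + (1 + δ) ^ 2 * w ^ 2| ≤
      100 * (r ^ 2 + q ^ 2) := by
  have b1 : δ ^ 2 ≤ 4 * q ^ 2 := by nlinarith
  have b2 : w ^ 2 ≤ 4 * r ^ 2 := by nlinarith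
  have b3 : 2 * (w * δ) ≤ w ^ 2 + δ ^ 2 := by nlinarith [sq_nonneg (w - δ)]
  have b4 : 0 ≤ w * δ := by positivity
  have b5 : w * δ * δ ≤ w * δ := mul_le_of_le_one_right b4 hδ1
  have b6 : 0 ≤ w * δ * δ := by positivity
  have b7 : (1 + δ) ^ 2 * w ^ 2 ≤ 4 * w ^ 2 := by
    refine mul_le_mul_of_nonneg_right ?_ (sq_nonneg w)
    nlinarith
  have b8 : 0 ≤ (1 + δ) ^ 2 * w ^ 2 := by positivity
  have b9 := sq_nonneg w
  have b10 := sq_nonneg δ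
  have e : w / 2 * (δ * (3 + 2 * δ)) = 3 / 2 * (w * δ) + w * δ * δ := by ring
  rw [e, abs_le]
  constructor <;> linarith

theorem abs_linear_remainder_le {δ w : ℝ} (hw0 : 0 ≤ w) (hw4 : w ≤ 1 / 4) (hδ0 : 0 ≤ δ)
    (hδ1 : δ ≤ 1) : |(1 + δ) / 2 - w / 2 + (1 + δ) ^ 2 * w| ≤ 3 := by
  have b7 : (1 + δ) ^ 2 * w ≤ 4 * w := by
    refine mul_le_mul_of_nonneg_right ?_ hw0
    nlinarith
  have b8 : 0 ≤ (1 + δ) ^ 2 * w := by positivity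
  rw [abs_le]
  constructor <;> linarith

/-- The kernel of the second time derivative gains the square of the parabolic factor `y² / t²`.
With `m = √(t² - y²)` and `I₁ = (1 - 1 / m + O(m⁻²)) I₀` the kernel becomes
`((1 - t / m)² / 4 + O((t / m - 1) / t + 1 / t²)) I₀`. -/
theorem abs_secondTimeKernel_le_of_abs_le_half {t y : ℝ} (ht : 2 ≤ t) (hy : |y| ≤ t / 2) :
    |secondTimeKernel t ((t ^ 2 - y ^ 2) / 16)| ≤
      4096 * (1 / t ^ 2 + (y ^ 2 / t ^ 2) ^ 2) * besselClifford 0 ((t ^ 2 - y ^ 2) / 16) := by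
  have ht0 : 0 < t := by linarith
  have hy2 : y ^ 2 ≤ t ^ 2 / 4 := by
    have := pow_le_pow_left₀ (abs_nonneg y) hy 2
    rw [sq_abs] at this
    linarith
  have hpos : 0 ≤ t ^ 2 - y ^ 2 := by nlinarith
  set m := Real.sqrt (t ^ 2 - y ^ 2) with hm
  have hm2 : m ^ 2 = t ^ 2 - y ^ 2 := Real.sq_sqrt hpos
  have hmt : t / 2 ≤ m := Real.le_sqrt_of_sq_le (by nlinarith)
  have hmt' : m ≤ t := Real.sqrt_le_iff.2 ⟨ht0.le, by nlinarith [sq_nonneg y]⟩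
  have hm0 : 0 < m := by linarith
  rw [← hm2]
  have hv : 0 ≤ m ^ 2 / 16 := by positivity
  set F := besselClifford 0 (m ^ 2 / 16) with hF
  have hF0 : 0 < F := besselClifford_pos 0 hv
  rcases lt_or_ge m 4 with h4 | h4
  · -- here `t < 8`, so the crude bound already decays like `t⁻²`
    refine (abs_secondTimeKernel_le ht hv).trans ?_
    have ht8 : t < 8 := by linarith
    have : t ^ 2 ≤ 4096 * (1 / t ^ 2) := by
      rw [mul_one_div, le_div_iff₀ (by positivity)]
      have : t ^ 2 ≤ 64 := by nlinarith
      nlinarith [sq_nonneg t]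
    gcongr
    have := sq_nonneg (y ^ 2 / t ^ 2)
    linarith
  · set H := m / 4 * besselClifford 1 (m ^ 2 / 16) with hH
    have hE : |H - (1 - 1 / m) * F| ≤ 12 / m ^ 2 * F := by
      have h := abs_besselClifford_one_sub_le (z := m / 2) (by linarith)
      have e1 : (m / 2) ^ 2 / 4 = m ^ 2 / 16 := by ring
      have e2 : m / 2 / 2 = m / 4 := by ring
      have e3 : 2 * (m / 2) = m := by ring
      have e4 : 3 / (m / 2) ^ 2 = 12 / m ^ 2 := by field_simp; norm_num
      rwa [e1, e2, e3, e4] at h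
    set E := H - (1 - 1 / m) * F with hEdef
    have hrec := besselClifford_recurrence 0 (m ^ 2 / 16)
    norm_num at hrec
    have hB1 : besselClifford 1 (m ^ 2 / 16) = 4 * H / m := by rw [hH]; field_simp
    have hB2 : besselClifford 2 (m ^ 2 / 16) = (F - 4 * H / m) * 16 / m ^ 2 := by
      rw [← hB1, hF, ← hrec]
      field_simp
      ring
    have hH' : H = (1 - 1 / m) * F + E := by rw [hEdef]; ring
    set δ := t / m - 1 with hδ
    set q := y ^ 2 / t ^ 2 with hq
    set r := 1 / t with hr
    set w := 1 / m with hw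
    have hq0 : 0 ≤ q := by positivity
    have hr0 : 0 < r := by positivity
    have hw0 : 0 < w := by positivity
    have hwr : w ≤ 2 * r := by
      rw [hw, hr, mul_one_div, div_le_div_iff₀ hm0 ht0]
      linarith
    have hw4 : w ≤ 1 / 4 := one_div_le_one_div_of_le (by norm_num) h4
    have hδ0 : 0 ≤ δ := by
      rw [hδ, sub_nonneg, le_div_iff₀ hm0]
      linarith
    have hδq : δ ≤ 2 * q := by
      have : δ = y ^ 2 / (m * (t + m)) := by
        rw [hδ, show y ^ 2 = (t - m) * (t + m) by nlinarith]
        field_simp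
      rw [this, hq, mul_div_assoc', div_le_div_iff₀ (by positivity) (by positivity)]
      have : t ^ 2 ≤ 2 * (m * (t + m)) := by nlinarith
      nlinarith [mul_le_mul_of_nonneg_left this (sq_nonneg y)]
    have hδ1 : δ ≤ 1 := by
      rw [hδ, sub_le_iff_le_add, div_le_iff₀ hm0]
      linarith
    have hL : secondTimeKernel t (m ^ 2 / 16) =
        (δ ^ 2 / 4 - w / 2 * (δ * (3 + 2 * δ)) - w ^ 2 / 2 + (1 + δ) ^ 2 * w ^ 2) * F -
          ((1 + δ) / 2 - w / 2 + (1 + δ) ^ 2 * w) * E := by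
      rw [secondTimeKernel, ← hF, hB1, hB2, hH', hδ, hw]
      field_simp
      ring
    have hE' : |E| ≤ 48 * r ^ 2 * F := by
      refine hE.trans (mul_le_mul_of_nonneg_right ?_ hF0.le)
      have : 12 / m ^ 2 = 12 * w ^ 2 := by rw [hw]; field_simp
      rw [this]
      have := pow_le_pow_left₀ hw0.le hwr 2
      linarith
    have hM := abs_quadratic_remainder_le hw0.le hwr hδ0 hδq hδ1
    have hN := abs_linear_remainder_le hw0.le hw4 hδ0 hδ1
    rw [hL]
    refine (abs_sub _ _).trans ?_
    rw [abs_mul, abs_mul, abs_of_pos hF0]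
    have c1 := mul_le_mul_of_nonneg_right hM hF0.le
    have c2 := mul_le_mul hN hE' (abs_nonneg _) (by norm_num)
    have c3 : 1 / t ^ 2 = r ^ 2 := by rw [hr]; field_simp
    rw [c3]
    have c4 : 0 ≤ r ^ 2 * F := by positivity
    have c5 : 0 ≤ q ^ 2 * F := by positivity
    calc _ ≤ 100 * (r ^ 2 + q ^ 2) * F + 3 * (48 * r ^ 2 * F) := add_le_add c1 c2
      _ = 244 * (r ^ 2 * F) + 100 * (q ^ 2 * F) := by ring
      _ ≤ 4096 * (r ^ 2 * F) + 4096 * (q ^ 2 * F) := by linarith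
      _ = _ := by ring

/-! ### Differentiation of integrals over growing intervals -/

theorem hasDerivAt_integral_zero_self {g g' : ℝ → ℝ → ℝ} (hg : Continuous (Function.uncurry g))
    (hg' : Continuous (Function.uncurry g'))
    (hd : ∀ t y, HasDerivAt (fun s => g s y) (g' t y) t) (t : ℝ) :
    HasDerivAt (fun t => ∫ y in (0 : ℝ)..t, g t y) (g t t + ∫ y in (0 : ℝ)..t, g' t y) t := by
  have hs : ∀ s, Continuous (g s) := fun s => hg.comp (Continuous.prodMk_right s)
  have hs' : ∀ s, Continuous (g' s) := fun s => hg'.comp (Continuous.prodMk_right s)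
  have h1 : ∀ a s : ℝ, HasDerivAt (fun a => ∫ y in (0 : ℝ)..a, g s y) (g s a) a := fun a s =>
    intervalIntegral.integral_hasDerivAt_right
      ((hs s).intervalIntegrable _ _)
      (hs s).stronglyMeasurable.stronglyMeasurableAtFilter
      (hs s).continuousAt
  have h2 : ∀ a s : ℝ, HasDerivAt (fun s => ∫ y in (0 : ℝ)..a, g s y)
      (∫ y in (0 : ℝ)..a, g' s y) s := fun a s => by
    obtain ⟨M, hM⟩ := ((isCompact_closedBall s 1).prod (isCompact_uIcc (a := (0 : ℝ)) (b := a))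
      ).exists_bound_of_continuousOn hg'.continuousOn
    refine (intervalIntegral.hasDerivAt_integral_of_dominated_loc_of_deriv_le
      (F' := g') (bound := fun _ => M) (Metric.closedBall_mem_nhds s one_pos)
      (Eventually.of_forall fun s =>
        (hs s).aestronglyMeasurable)
      ((hs s).intervalIntegrable _ _)
      (hs' s).aestronglyMeasurable
      (Eventually.of_forall fun y hy x hx => hM (x, y) ⟨hx, uIoc_subset_uIcc hy⟩)
      intervalIntegrable_const
      (Eventually.of_forall fun y _ x _ => hd x y)).2
  have c2 : Continuous fun p : ℝ × ℝ => ∫ y in (0 : ℝ)..p.1, g' p.2 y :=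
    intervalIntegral.continuous_parametric_intervalIntegral_of_continuous
      (f := fun p : ℝ × ℝ => g' p.2)
      (hg'.comp (f := fun p : (ℝ × ℝ) × ℝ => (p.1.2, p.2)) (by fun_prop)) continuous_fst
  have key := hasStrictFDerivAt_uncurry_coprod (𝕜 := ℝ) (u := (t, t))
    (f := fun a s => ∫ y in (0 : ℝ)..a, g s y)
    (f₁ := fun a s => ContinuousLinearMap.toSpanSingleton ℝ (g s a))
    (f₂ := fun a s => ContinuousLinearMap.toSpanSingleton ℝ (∫ y in (0 : ℝ)..a, g' s y))
    (Eventually.of_forall fun p => (h1 p.1 p.2).hasFDerivAt)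
    (Eventually.of_forall fun p => (h2 p.1 p.2).hasFDerivAt)
    (by
      refine Continuous.continuousAt ?_
      have : Continuous fun p : ℝ × ℝ => g p.2 p.1 :=
        hg.comp (f := fun p : ℝ × ℝ => (p.2, p.1)) (by fun_prop)
      exact (ContinuousLinearMap.toSpanSingletonCLE (𝕜 := ℝ) (E := ℝ)).continuous.comp this)
    (by
      refine Continuous.continuousAt ?_
      exact (ContinuousLinearMap.toSpanSingletonCLE (𝕜 := ℝ) (E := ℝ)).continuous.comp c2)
  have hdiag : HasDerivAt (fun t : ℝ => (t, t)) ((1 : ℝ), (1 : ℝ)) t :=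
    (hasDerivAt_id t).prodMk (hasDerivAt_id t)
  have := HasFDerivAt.comp_hasDerivAt (f := fun t : ℝ => (t, t)) t key.hasFDerivAt hdiag
  convert! this using 1
  simp [Function.HasUncurry.uncurry]

theorem integral_neg_self_eq {f : ℝ → ℝ} (hf : Continuous f) (t : ℝ) :
    ∫ y in (-t)..t, f y = ∫ y in (0 : ℝ)..t, (f y + f (-y)) := by
  have hf' : Continuous fun y => f (-y) := hf.comp continuous_neg
  rw [intervalIntegral.integral_add (hf.intervalIntegrable _ _)
      (hf'.intervalIntegrable _ _), intervalIntegral.integral_comp_neg,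
    neg_zero, add_comm, intervalIntegral.integral_add_adjacent_intervals
      (hf.intervalIntegrable _ _) (hf.intervalIntegrable _ _)]

/-- The Leibniz rule for an integral over `(-t, t)`. -/
theorem hasDerivAt_integral_neg_self {g g' : ℝ → ℝ → ℝ} (hg : Continuous (Function.uncurry g))
    (hg' : Continuous (Function.uncurry g'))
    (hd : ∀ t y, HasDerivAt (fun s => g s y) (g' t y) t) (t : ℝ) :
    HasDerivAt (fun t => ∫ y in (-t)..t, g t y)
      (g t t + g t (-t) + ∫ y in (-t)..t, g' t y) t := by
  have h := hasDerivAt_integral_zero_self (g := fun t y => g t y + g t (-y))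
    (g' := fun t y => g' t y + g' t (-y))
    (hg.add (hg.comp (f := fun p : ℝ × ℝ => (p.1, -p.2)) (by fun_prop)))
    (hg'.add (hg'.comp (f := fun p : ℝ × ℝ => (p.1, -p.2)) (by fun_prop)))
    (fun t y => (hd t y).add (hd t (-y))) t
  rw [integral_neg_self_eq (f := g' t) (hg'.comp (Continuous.prodMk_right t))]
  convert! h using 1
  ext s
  exact integral_neg_self_eq (hg.comp (Continuous.prodMk_right s)) s

theorem continuous_integral_neg_self {g : ℝ → ℝ → ℝ} (hg : Continuous (Function.uncurry g)) :
    Continuous fun t => ∫ y in (-t)..t, g t y := by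
  have h : Continuous fun t => ∫ y in (0 : ℝ)..t, (g t y + g t (-y)) :=
    intervalIntegral.continuous_parametric_intervalIntegral_of_continuous
      (f := fun t y => g t y + g t (-y))
      (hg.add (hg.comp (f := fun p : ℝ × ℝ => (p.1, -p.2)) (by fun_prop))) continuous_id
  refine h.congr fun t => ?_
  exact (integral_neg_self_eq (hg.comp (Continuous.prodMk_right t)) t).symm

/-! ### The Lipschitz representative of a Sobolev function -/

theorem hasCompactSupport_integral_of_integral_eq_zero {w : ℝ → ℝ} {R : ℝ}
    (hsupp : Function.support w ⊆ Ioc (-R) R) (hw0 : ∫ x, w x = 0) :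
    HasCompactSupport fun x => ∫ y in (-R)..x, w y := by
  refine HasCompactSupport.intro (isCompact_Icc (a := -R) (b := R)) fun x hx => ?_
  rcases lt_or_ge x (-R) with h | h
  · rw [intervalIntegral.integral_symm, neg_eq_zero]
    refine intervalIntegral.integral_zero_ae (Eventually.of_forall fun y hy => ?_)
    rw [uIoc_of_le h.le] at hy
    by_contra hne
    exact absurd (hsupp hne).1 (not_lt.2 hy.2)
  · have hR : R < x := by
      by_contra hc
      exact hx ⟨h, not_lt.1 hc⟩
    rw [intervalIntegral.integral_eq_integral_of_support_subset
      (hsupp.trans (Ioc_subset_Ioc_right hR.le)), hw0]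

theorem HasCompactSupport.exists_support_subset_Ioc {θ : ℝ → ℝ} (hθ : HasCompactSupport θ) :
    ∃ R₀ : ℝ, ∀ R, R₀ ≤ R → Function.support θ ⊆ Ioc (-R) R := by
  obtain ⟨r, hr⟩ := hθ.isCompact.isBounded.subset_closedBall 0
  refine ⟨r + 1, fun R hR x hx => ?_⟩
  have := hr (subset_tsupport θ hx)
  rw [Metric.mem_closedBall, dist_zero_right, Real.norm_eq_abs, abs_le] at this
  constructor <;> linarith [this.1, this.2]

/-- The du Bois-Reymond lemma: a locally integrable function whose weak derivative vanishes is
almost everywhere constant. -/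
theorem ae_eq_const_of_integral_mul_deriv_eq_zero {u : ℝ → ℝ} (hu : LocallyIntegrable u volume)
    (h : ∀ θ : ℝ → ℝ, ContDiff ℝ (⊤ : ℕ∞) θ → HasCompactSupport θ → ∫ x, u x * deriv θ x = 0) :
    ∃ c : ℝ, ∀ᵐ x : ℝ, u x = c := by
  let b : ContDiffBump (0 : ℝ) := default
  set η : ℝ → ℝ := b.normed volume
  have hη1 : ContDiff ℝ (⊤ : ℕ∞) η := b.contDiff_normed
  have hη2 : HasCompactSupport η := b.hasCompactSupport_normed
  have hη3 : ∫ x, η x = 1 := b.integral_normed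
  have hint : ∀ θ : ℝ → ℝ, ContDiff ℝ (⊤ : ℕ∞) θ → HasCompactSupport θ →
      Integrable (fun x => u x * θ x) := fun θ h1 h2 => by
    have := hu.integrable_smul_left_of_hasCompactSupport h1.continuous h2
    simpa [mul_comm] using this
  refine ⟨∫ x, u x * η x, ae_eq_of_integral_contDiff_smul_eq hu (locallyIntegrable_const _)
    fun θ hθ1 hθ2 => ?_⟩
  -- `θ - (∫ θ) η` has integral zero, hence is the derivative of a test function
  set w : ℝ → ℝ := fun x => θ x - (∫ y, θ y) * η x with hw
  have hw1 : ContDiff ℝ (⊤ : ℕ∞) w := hθ1.sub (contDiff_const.mul hη1)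
  have hw2 : HasCompactSupport w := hθ2.sub (hη2.mul_left (f := fun _ => ∫ y, θ y))
  have hw0 : ∫ x, w x = 0 := by
    rw [integral_sub (hθ1.continuous.integrable_of_hasCompactSupport hθ2)
      ((hη1.continuous.integrable_of_hasCompactSupport hη2).const_mul _), integral_const_mul, hη3]
    ring
  obtain ⟨R, hR⟩ := hw2.exists_support_subset_Ioc
  have hd : ∀ x, HasDerivAt (fun x => ∫ y in (-R)..x, w y) (w x) x := fun x =>
    intervalIntegral.integral_hasDerivAt_right (hw1.continuous.intervalIntegrable _ _)
      hw1.continuous.stronglyMeasurable.stronglyMeasurableAtFilter hw1.continuous.continuousAt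
  have hderiv : deriv (fun x => ∫ y in (-R)..x, w y) = w := funext fun x => (hd x).deriv
  have key := h (fun x => ∫ y in (-R)..x, w y)
    (contDiff_infty_iff_deriv.2 ⟨fun x => (hd x).differentiableAt, by rw [hderiv]; exact hw1⟩)
    (hasCompactSupport_integral_of_integral_eq_zero (hR R le_rfl) hw0)
  rw [hderiv] at key
  have e : ∀ x, u x * w x = u x * θ x - (∫ y, θ y) * (u x * η x) := fun x => by
    rw [hw]; ring
  simp only [e] at key
  rw [integral_sub (hint θ hθ1 hθ2) ((hint η hη1 hη2).const_mul _), integral_const_mul] at key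
  simp only [smul_eq_mul]
  rw [integral_mul_const]
  simp only [mul_comm (θ _)]
  linarith

theorem integral_mul_deriv_of_lipschitzWith {F f θ : ℝ → ℝ} {K : NNReal} (hF : LipschitzWith K F)
    (hFf : ∀ᵐ x, HasDerivAt F (f x) x) (hθ : ContDiff ℝ (⊤ : ℕ∞) θ)
    (hθ' : HasCompactSupport θ) : ∫ x, F x * deriv θ x = -∫ x, f x * θ x := by
  obtain ⟨R₁, hR₁⟩ := hθ'.exists_support_subset_Ioc
  obtain ⟨R₂, hR₂⟩ := hθ'.deriv.exists_support_subset_Ioc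
  set R := max R₁ R₂ + 1
  have h1 : Function.support θ ⊆ Ioc (-R) R :=
    hR₁ R ((le_max_left _ _).trans (lt_add_one _).le)
  have h2 : Function.support (deriv θ) ⊆ Ioc (-R) R :=
    hR₂ R ((le_max_right _ _).trans (lt_add_one _).le)
  have hac := (hF.lipschitzOnWith (s := uIcc (-R) R)).absolutelyContinuousOnInterval
  obtain ⟨K', hK'⟩ := (hθ.of_le (by exact_mod_cast le_top)).locallyLipschitz.locallyLipschitzOn
    |>.exists_lipschitzOnWith_of_compact (s := uIcc (-R) R) isCompact_uIcc
  have key := hac.integral_mul_deriv_eq_deriv_mul hK'.absolutelyContinuousOnInterval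
  have hz1 : θ (-R) = 0 := by
    by_contra hne
    exact lt_irrefl _ (h1 hne).1
  have hz2 : θ R = 0 := by
    by_contra hne
    have := (hR₁ (max R₁ R₂) (le_max_left _ _) hne).2
    exact absurd this (not_le.2 (lt_add_one _))
  rw [hz1, hz2, mul_zero, mul_zero, sub_zero, zero_sub,
    intervalIntegral.integral_eq_integral_of_support_subset
      ((Function.support_mul_subset_right _ _).trans h2),
    intervalIntegral.integral_eq_integral_of_support_subset
      ((Function.support_mul_subset_right _ _).trans h1)] at key
  rw [key]
  congr 1
  refine integral_congr_ae ?_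
  filter_upwards [hFf] with x hx
  rw [hx.deriv]

/-- A function in `W^{1,1} ∩ W^{1,∞}` agrees almost everywhere with a Lipschitz function that is an
integral of its weak derivative. -/
theorem MemW11W1Infty.exists_lipschitzWith {φ φ' : ℝ → ℝ} (h : MemW11W1Infty φ φ') :
    ∃ (ψ : ℝ → ℝ) (K : NNReal), LipschitzWith K ψ ∧ (∀ᵐ x, φ x = ψ x) ∧
      ∀ a b, ψ b - ψ a = ∫ x in a..b, φ' x := by
  obtain ⟨hφ, hφ', hweak⟩ := h.hasWeakDeriv
  have hint : Integrable φ' := memLp_one_iff_integrable.1 h.deriv_memLp_one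
  have hii : ∀ a b, IntervalIntegrable φ' volume a b := fun a b => hint.intervalIntegrable
  set F : ℝ → ℝ := fun x => ∫ y in (0 : ℝ)..x, φ' y with hF
  have hsub : ∀ a b, F b - F a = ∫ x in a..b, φ' x := fun a b =>
    intervalIntegral.integral_interval_sub_left (hii _ _) (hii _ _)
  set K : NNReal := (eLpNormEssSup φ' volume).toNNReal
  have hK : ∀ᵐ x, ‖φ' x‖ ≤ K := by
    have hne : eLpNormEssSup φ' volume ≠ ⊤ := by
      have := h.deriv_memLp_top.2
      rw [eLpNorm_exponent_top] at this
      exact this.ne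
    filter_upwards [enorm_ae_le_eLpNormEssSup φ' volume] with x hx
    have := ENNReal.toNNReal_mono hne hx
    rw [← coe_nnnorm]
    exact_mod_cast this
  have hlip : LipschitzWith K F := by
    refine LipschitzWith.of_dist_le_mul fun a b => ?_
    rw [dist_eq_norm, Real.dist_eq, hsub]
    exact intervalIntegral.norm_integral_le_of_norm_le_const_ae
      (by filter_upwards [hK] with x hx _ using hx)
  have hd : ∀ᵐ x, HasDerivAt F (φ' x) x := by
    filter_upwards [LocallyIntegrable.ae_hasDerivAt_integral hφ'] with x hx using hx 0
  have hFl : LocallyIntegrable F volume := hlip.continuous.locallyIntegrable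
  obtain ⟨c, hc⟩ := ae_eq_const_of_integral_mul_deriv_eq_zero (hφ.sub hFl) fun θ h1 h2 => by
    have hi : ∀ f : ℝ → ℝ, LocallyIntegrable f volume →
        Integrable (fun x => f x * deriv θ x) := fun f hf => by
      have := hf.integrable_smul_left_of_hasCompactSupport
        (h1.continuous_deriv (by exact_mod_cast le_top)) h2.deriv
      simpa [mul_comm] using this
    simp only [Pi.sub_apply, sub_mul]
    rw [integral_sub (hi φ hφ) (hi F hFl), hweak θ h1 h2,
      integral_mul_deriv_of_lipschitzWith hlip hd h1 h2, sub_self]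
  refine ⟨fun x => F x + c, K, ?_, ?_, fun a b => ?_⟩
  · refine LipschitzWith.of_dist_le_mul fun a b => ?_
    rw [dist_add_right]
    exact hlip.dist_le_mul a b
  · filter_upwards [hc] with x hx
    simp only [Pi.sub_apply] at hx
    linarith
  · rw [← hsub]
    ring

/-! ### Doubling weights -/

/-- The pointwise form, for a continuous representative, of the conditions on the weight: it is
comparable to its values at distance less than `1`, it is at most `C` times its values on
`(-2 |x|, 2 |x|)`, and its logarithmic derivative is bounded. -/
structure IsDoublingWeight (ψ : ℝ → ℝ) (C : ℝ) : Prop where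
  continuous : Continuous ψ
  pos : ∀ x, 0 < ψ x
  le_of_near : ∀ x y, |y - x| < 1 → ψ x ≤ C * ψ y
  le_of_abs_lt : ∀ x y, |y| < 2 * |x| → ψ x ≤ C * ψ y
  abs_sub_le : ∀ a b, |b - a| < 1 → |ψ b - ψ a| ≤ C ^ 2 * ψ a * |b - a|

theorem forall_mem_le_of_ae {f g : ℝ → ℝ} (hf : Continuous f) (hg : Continuous g) {U : Set ℝ}
    (hU : IsOpen U) (h : ∀ᵐ y : ℝ, y ∈ U → f y ≤ g y) : ∀ y ∈ U, f y ≤ g y := by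
  have hopen : IsOpen (U ∩ {y | g y < f y}) := hU.inter (isOpen_lt hg hf)
  have h0 : volume (U ∩ {y | g y < f y}) = 0 := by
    refine measure_mono_null (fun y hy => ?_) h
    rw [mem_compl_iff]
    change ¬(y ∈ U → f y ≤ g y)
    rw [not_forall]
    exact ⟨hy.1, not_le.2 hy.2⟩
  intro y hy
  by_contra hc
  have : y ∈ U ∩ {y | g y < f y} := ⟨hy, not_le.1 hc⟩
  rw [(hopen.measure_eq_zero_iff volume).1 h0] at this
  exact this

/-- For a continuous function, an inequality between its values at almost all pairs of points in an
open relation holds at all such pairs. -/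
theorem forall_le_mul_of_ae {ψ : ℝ → ℝ} (hψ : Continuous ψ) {C : ℝ} {r : ℝ → ℝ → Prop}
    (hr1 : ∀ x, IsOpen {y | r x y}) (hr2 : ∀ y, IsOpen {x | r x y})
    (h : ∀ᵐ x : ℝ, ∀ᵐ y : ℝ, r x y → ψ x ≤ C * ψ y) (x y : ℝ) (hxy : r x y) :
    ψ x ≤ C * ψ y := by
  have h1 : ∀ᵐ x : ℝ, ∀ y, r x y → ψ x ≤ C * ψ y := by
    filter_upwards [h] with x hx
    exact forall_mem_le_of_ae continuous_const (hψ.const_mul C) (hr1 x) hx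
  refine forall_mem_le_of_ae (U := {x | r x y}) hψ continuous_const (hr2 y) ?_ x hxy
  filter_upwards [h1] with x hx using hx y

theorem isDoublingWeight_of_ae {φ φ' ψ : ℝ → ℝ} {C : ℝ} (hψ : Continuous ψ)
    (hφψ : ∀ᵐ x, φ x = ψ x) (hsub : ∀ a b, ψ b - ψ a = ∫ x in a..b, φ' x)
    (hpos : ∃ Cδ : ℝ, 0 < Cδ ∧ ∀ᵐ x : ℝ, Real.exp (-1 * |x|) ≤ Cδ * φ x)
    (h1 : ∀ᵐ x : ℝ, ∀ᵐ y : ℝ, y ∈ Ioo (x - 1) (x + 1) → φ x ≤ C * φ y)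
    (h2 : ∀ᵐ x : ℝ, ∀ᵐ y : ℝ, |y| < 2 * |x| → φ x ≤ C * φ y)
    (h3 : ∀ᵐ x : ℝ, |φ' x| ≤ C * φ x) : IsDoublingWeight ψ C := by
  have hp : ∀ x, 0 < ψ x := fun x => by
    obtain ⟨c, hc, h⟩ := hpos
    have := forall_mem_le_of_ae (f := fun x => Real.exp (-1 * |x|)) (g := fun x => c * ψ x)
      (by fun_prop) (hψ.const_mul c) isOpen_univ
      (by filter_upwards [h, hφψ] with x hx h' _; rwa [← h']) x (mem_univ x)
    exact pos_of_mul_pos_right ((Real.exp_pos _).trans_le this) hc.le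
  have hnear : ∀ x y, |y - x| < 1 → ψ x ≤ C * ψ y := by
    refine forall_le_mul_of_ae (r := fun x y => |y - x| < 1) hψ
      (fun x => isOpen_lt (by fun_prop) continuous_const)
      (fun y => isOpen_lt (by fun_prop) continuous_const) ?_
    filter_upwards [h1, hφψ] with x hx hx'
    filter_upwards [hx, hφψ] with y hy hy' hxy
    rw [abs_lt] at hxy
    rw [← hx', ← hy']
    exact hy ⟨by linarith [hxy.1], by linarith [hxy.2]⟩
  have hC : 1 ≤ C := by
    have := hnear 0 0 (by simp)
    exact le_of_mul_le_mul_right (by simpa using this) (hp 0)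
  refine ⟨hψ, hp, hnear, ?_, fun a b hab => ?_⟩
  · refine forall_le_mul_of_ae (r := fun x y => |y| < 2 * |x|) hψ
      (fun x => isOpen_lt (by fun_prop) (by fun_prop))
      (fun y => isOpen_lt (by fun_prop) (by fun_prop)) ?_
    filter_upwards [h2, hφψ] with x hx hx'
    filter_upwards [hx, hφψ] with y hy hy' hxy
    rw [← hx', ← hy']
    exact hy hxy
  · rw [hsub]
    suffices hbound : ∀ᵐ z, z ∈ uIoc a b → ‖φ' z‖ ≤ C ^ 2 * ψ a from
      intervalIntegral.norm_integral_le_of_norm_le_const_ae hbound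
    filter_upwards [h3, hφψ] with z hz hz' hzab
    have hza : |a - z| < 1 := by
      rw [abs_sub_comm]
      have h := abs_sub_left_of_mem_uIcc (uIoc_subset_uIcc hzab)
      exact h.trans_lt hab
    refine hz.trans ?_
    rw [hz', sq, mul_assoc]
    exact mul_le_mul_of_nonneg_left (hnear z a hza) (by linarith)

namespace IsDoublingWeight

variable {ψ : ℝ → ℝ} {C : ℝ}

theorem one_le (h : IsDoublingWeight ψ C) : 1 ≤ C := by
  have := h.le_of_near 0 0 (by simp)
  exact le_of_mul_le_mul_right (by simpa using this) (h.pos 0)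

theorem le_pow_mul (h : IsDoublingWeight ψ C) {z : ℝ} (hz : z ≠ 0) (n : ℕ) :
    ∀ x, |x| ≤ (3 / 2) ^ n * |z| → ψ z ≤ C ^ (n + 1) * ψ x := by
  have hz' := abs_pos.2 hz
  induction n with
  | zero =>
    intro x hx
    simpa using h.le_of_abs_lt z x (by rw [pow_zero, one_mul] at hx; linarith)
  | succ n ih =>
    intro x hx
    have h1 : |2 / 3 * x| = 2 / 3 * |x| := by rw [abs_mul, abs_of_pos (by norm_num)]
    have h2 := ih (2 / 3 * x) (by rw [h1]; rw [pow_succ] at hx; linarith)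
    have h3 : ψ (2 / 3 * x) ≤ C * ψ x := by
      rcases eq_or_ne x 0 with rfl | hx0
      · exact h.le_of_near _ _ (by simp)
      · have := abs_pos.2 hx0
        exact h.le_of_abs_lt _ _ (by rw [h1]; linarith)
    have hC := h.one_le
    calc ψ z ≤ C ^ (n + 1) * ψ (2 / 3 * x) := h2
      _ ≤ C ^ (n + 1) * (C * ψ x) := by gcongr
      _ = C ^ (n + 1 + 1) * ψ x := by ring

/-- Doubling makes the weight vary at most polynomially. -/
theorem exists_le_pow_mul (h : IsDoublingWeight ψ C) :
    ∃ (A : ℝ) (p : ℕ), 0 < A ∧ ∀ t x y : ℝ, 2 ≤ t → |y| ≤ t → ψ (x - y) ≤ A * t ^ p * ψ x := by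
  obtain ⟨p, hp⟩ := pow_unbounded_of_one_lt C (show (1 : ℝ) < 3 / 2 by norm_num)
  have hC := h.one_le
  refine ⟨12 ^ p, p, by positivity, fun t x y ht hy => ?_⟩
  -- a point near `x - y` that stays away from the origin
  obtain ⟨z, hz1, hz2⟩ : ∃ z, |z - (x - y)| ≤ 1 / 2 ∧ 1 / 2 ≤ |z| := by
    rcases le_or_gt 0 (x - y) with h0 | h0
    · exact ⟨x - y + 1 / 2, by simp [abs_of_pos], (le_abs_self _).trans' (by linarith)⟩
    · refine ⟨x - y - 1 / 2, ?_, (neg_le_abs _).trans' (by linarith)⟩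
      rw [show x - y - 1 / 2 - (x - y) = -(1 / 2) by ring, abs_neg, abs_of_pos (by norm_num)]
  have hz0 : z ≠ 0 := by
    rintro rfl
    norm_num at hz2
  obtain ⟨n, hn1, hn2⟩ := exists_nat_pow_near (show (1 : ℝ) ≤ 2 + 2 * t by linarith)
    (show (1 : ℝ) < 3 / 2 by norm_num)
  have hx : |x| ≤ (3 / 2) ^ (n + 1) * |z| := by
    have e1 : |x| ≤ |z| + 1 / 2 + t := by
      have : x = z - (z - (x - y)) + y := by ring
      calc |x| = |z - (z - (x - y)) + y| := by rw [← this]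
        _ ≤ |z| + |z - (x - y)| + |y| := (abs_add_le _ _).trans (by gcongr; exact abs_sub _ _)
        _ ≤ _ := by gcongr
    nlinarith
  have h1 := h.le_of_near (x - y) z (by linarith)
  have h2 := h.le_pow_mul hz0 (n + 1) x hx
  have h3 : C ^ (n + 3) ≤ 12 ^ p * t ^ p := by
    calc C ^ (n + 3) ≤ ((3 / 2) ^ p) ^ (n + 3) := by gcongr
      _ = ((3 / 2) ^ n * (27 / 8)) ^ p := by
        rw [← pow_mul, mul_comm p, pow_mul, pow_add]
        norm_num
      _ ≤ (12 * t) ^ p := by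
        refine pow_le_pow_left₀ (by positivity) ?_ p
        linarith
      _ = _ := mul_pow _ _ _
  calc ψ (x - y) ≤ C * (C ^ (n + 1 + 1) * ψ x) := h1.trans (by gcongr)
    _ = C ^ (n + 3) * ψ x := by ring
    _ ≤ _ := mul_le_mul_of_nonneg_right h3 (h.pos x).le

end IsDoublingWeight

/-! ### Size of the wave kernel -/

/-- The heat kernel bound `e^{-t/2} I₀(√(t² - y²) / 2) ≤ e^{-y²/(4t)}`. -/
theorem exp_mul_besselClifford_le {t y : ℝ} (ht : 0 < t) (hy : |y| ≤ t) :
    Real.exp (-t / 2) * besselClifford 0 ((t ^ 2 - y ^ 2) / 16) ≤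
      Real.exp (-(y ^ 2 / (4 * t))) := by
  have hy2 : y ^ 2 ≤ t ^ 2 := sq_le_sq' (abs_le.1 hy).1 (abs_le.1 hy).2
  set m := Real.sqrt (t ^ 2 - y ^ 2)
  have hm2 : m ^ 2 = t ^ 2 - y ^ 2 := Real.sq_sqrt (by linarith)
  have hm0 : 0 ≤ m := Real.sqrt_nonneg _
  have hm : m ≤ t - y ^ 2 / (2 * t) := by
    have h1 : y ^ 2 / (2 * t) ≤ t := by
      rw [div_le_iff₀ (by positivity)]
      nlinarith
    refine Real.sqrt_le_iff.2 ⟨by linarith, ?_⟩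
    have h2 : (t - y ^ 2 / (2 * t)) ^ 2 = t ^ 2 - y ^ 2 + (y ^ 2 / (2 * t)) ^ 2 := by
      field_simp
      ring
    rw [h2]
    linarith [sq_nonneg (y ^ 2 / (2 * t))]
  have h := besselClifford_zero_le_exp (z := m / 2) (by linarith)
  rw [show (m / 2) ^ 2 / 4 = (t ^ 2 - y ^ 2) / 16 by rw [← hm2]; ring] at h
  refine (mul_le_mul_of_nonneg_left h (Real.exp_pos _).le).trans ?_
  rw [← Real.exp_add, Real.exp_le_exp]
  have h3 : y ^ 2 / (4 * t) = y ^ 2 / (2 * t) / 2 := by field_simp; norm_num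
  rw [h3]
  linarith

theorem le_exp_mul_besselClifford {t y : ℝ} (ht : 2 ≤ t) (hy : |y| ≤ 1 / 2) :
    1 / (4 * t) ≤ Real.exp (-t / 2) * besselClifford 0 ((t ^ 2 - y ^ 2) / 16) := by
  have hy2 : y ^ 2 ≤ 1 / 4 := by
    have := sq_le_sq' (abs_le.1 hy).1 (abs_le.1 hy).2
    linarith
  set m := Real.sqrt (t ^ 2 - y ^ 2)
  have hm2 : m ^ 2 = t ^ 2 - y ^ 2 := Real.sq_sqrt (by nlinarith)
  have hm : t - 1 ≤ m := Real.le_sqrt_of_sq_le (by nlinarith)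
  have hmt : m ≤ t := Real.sqrt_le_iff.2 ⟨by linarith, by nlinarith [sq_nonneg y]⟩
  have h := sinh_le_mul_besselClifford_zero (z := m / 2) (by linarith)
  rw [show (m / 2) ^ 2 / 4 = (t ^ 2 - y ^ 2) / 16 by rw [← hm2]; ring] at h
  set B := besselClifford 0 ((t ^ 2 - y ^ 2) / 16)
  have hB : 0 < B := besselClifford_pos 0 (by nlinarith)
  have h1 : Real.exp (m / 2) / 4 ≤ Real.sinh (m / 2) := by
    have e1 : Real.exp (m / 2) * Real.exp (-(m / 2)) = 1 := by
      rw [← Real.exp_add, add_neg_cancel, Real.exp_zero]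
    have e2 : 1 + m / 2 ≤ Real.exp (m / 2) := by linarith [Real.add_one_le_exp (m / 2)]
    have e3 := Real.exp_pos (-(m / 2))
    have e4 : 3 / 2 * Real.exp (-(m / 2)) ≤ 1 := by nlinarith
    rw [Real.sinh_eq]
    nlinarith
  have h2 : Real.exp ((t - 1) / 2) / 4 ≤ t / 2 * B := by
    calc Real.exp ((t - 1) / 2) / 4 ≤ Real.exp (m / 2) / 4 := by gcongr
      _ ≤ m / 2 * B := h1.trans h
      _ ≤ t / 2 * B := by gcongr
  have h3 : (1 : ℝ) / 2 ≤ Real.exp (-t / 2) * Real.exp ((t - 1) / 2) := by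
    rw [← Real.exp_add]
    have := Real.add_one_le_exp (-t / 2 + (t - 1) / 2)
    linarith
  have h4 := mul_le_mul_of_nonneg_left h2 (Real.exp_pos (-t / 2)).le
  rw [div_le_iff₀ (by linarith)]
  nlinarith

/-- A stretched exponential decays faster than any power. -/
theorem exists_pow_mul_exp_neg_rpow_le {α : ℝ} (hα : 0 < α) (n : ℕ) :
    ∃ M : ℝ, 0 < M ∧ ∀ t : ℝ, 1 ≤ t → t ^ n * Real.exp (-(t ^ α / 16)) ≤ M := by
  obtain ⟨N, hN⟩ := exists_nat_ge (n / α)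
  refine ⟨16 ^ N * (Nat.factorial N : ℝ), by positivity, fun t ht => ?_⟩
  have ht0 : 0 < t := by linarith
  have h1 : t ^ n ≤ (t ^ α) ^ N := by
    rw [← Real.rpow_natCast t n, ← Real.rpow_natCast (t ^ α) N, ← Real.rpow_mul ht0.le]
    refine Real.rpow_le_rpow_of_exponent_le ht ?_
    rw [div_le_iff₀ hα] at hN
    linarith
  have h2 := Real.pow_div_factorial_le_exp (x := t ^ α / 16) (by positivity) N
  rw [Real.exp_neg, ← div_eq_mul_inv, div_le_iff₀ (Real.exp_pos _)]
  rw [div_pow, div_div, div_le_iff₀ (by positivity)] at h2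
  linarith

/-! ### Time derivatives of the solution operator -/

theorem besselClifford_zero_zero : besselClifford 0 0 = 1 := by
  rw [besselClifford, tsum_eq_single 0 fun k hk => by simp [hk]]
  simp

theorem besselClifford_one_zero : besselClifford 1 0 = 1 := by
  rw [besselClifford, tsum_eq_single 0 fun k hk => by simp [hk]]
  simp

theorem dampedWaveS_eq {φ ψ : ℝ → ℝ} (h : ∀ᵐ x, φ x = ψ x) (t x : ℝ) :
    dampedWaveS t φ x = Real.exp (-t / 2) / 2 *
      ∫ y in (-t)..t, besselClifford 0 ((t ^ 2 - y ^ 2) / 16) * ψ (x - y) := by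
  rw [dampedWaveS]
  congr 1
  refine intervalIntegral.integral_congr_ae ?_
  have hx : ∀ᵐ y, φ (x - y) = ψ (x - y) :=
    (Measure.measurePreserving_sub_left volume x).quasiMeasurePreserving.ae h
  filter_upwards [hx] with y hy hyt
  have hyt' : |y| ≤ |t| := by
    have := uIoc_subset_uIcc hyt
    rw [mem_uIcc] at this
    rcases this with h | h
    · exact (abs_le.2 ⟨h.1, h.2⟩).trans (le_abs_self t)
    · exact (abs_le.2 ⟨by linarith [h.1], by linarith [h.2]⟩).trans (neg_le_abs t)
  have hsq : 0 ≤ t ^ 2 - y ^ 2 := sub_nonneg.2 (sq_le_sq.2 hyt')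
  rw [hy, besselI0_eq, div_pow, Real.sq_sqrt hsq]
  congr 2
  ring

theorem hasDerivAt_besselClifford_cone (n : ℕ) (t y : ℝ) :
    HasDerivAt (fun t : ℝ => besselClifford n ((t ^ 2 - y ^ 2) / 16))
      (t / 8 * besselClifford (n + 1) ((t ^ 2 - y ^ 2) / 16)) t := by
  have h1 : HasDerivAt (fun t : ℝ => (t ^ 2 - y ^ 2) / 16) (t / 8) t := by
    convert! ((hasDerivAt_pow 2 t).sub_const (y ^ 2)).div_const 16 using 1
    push_cast
    ring
  convert! (hasDerivAt_besselClifford n ((t ^ 2 - y ^ 2) / 16)).comp t h1 using 1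
  ring

/-- The convolution of `ψ` with a kernel `k t` over `(-t, t)`, at the point `x`. -/
noncomputable def coneIntegral (k : ℝ → ℝ → ℝ) (ψ : ℝ → ℝ) (x t : ℝ) : ℝ :=
  ∫ y in (-t)..t, k t ((t ^ 2 - y ^ 2) / 16) * ψ (x - y)

theorem continuous_coneIntegrand {k : ℝ → ℝ → ℝ} (hk : Continuous (Function.uncurry k))
    {ψ : ℝ → ℝ} (hψ : Continuous ψ) (x : ℝ) : Continuous
      (Function.uncurry fun t y : ℝ => k t ((t ^ 2 - y ^ 2) / 16) * ψ (x - y)) := by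
  have h1 : Continuous fun p : ℝ × ℝ => k p.1 ((p.1 ^ 2 - p.2 ^ 2) / 16) :=
    hk.comp (f := fun p : ℝ × ℝ => (p.1, (p.1 ^ 2 - p.2 ^ 2) / 16)) (by fun_prop)
  exact h1.mul (hψ.comp (by fun_prop))

theorem continuous_coneIntegrand_apply {k : ℝ → ℝ → ℝ} (hk : Continuous (Function.uncurry k))
    {ψ : ℝ → ℝ} (hψ : Continuous ψ) (x t : ℝ) :
    Continuous fun y => k t ((t ^ 2 - y ^ 2) / 16) * ψ (x - y) :=
  (continuous_coneIntegrand hk hψ x).comp (Continuous.prodMk_right t)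

theorem continuous_uncurry_besselClifford (n : ℕ) :
    Continuous (Function.uncurry fun _ v : ℝ => besselClifford n v) :=
  (continuous_besselClifford n).comp continuous_snd

theorem continuous_uncurry_firstTimeKernel :
    Continuous (Function.uncurry fun t v : ℝ => t / 8 * besselClifford 1 v) :=
  (continuous_fst.div_const 8).mul (continuous_uncurry_besselClifford 1)

theorem continuous_uncurry_firstTimeKernel_deriv :
    Continuous (Function.uncurry fun t v : ℝ =>
      besselClifford 1 v / 8 + t ^ 2 / 64 * besselClifford 2 v) :=
  ((continuous_uncurry_besselClifford 1).div_const 8).add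
    (((continuous_fst.pow 2).div_const 64).mul (continuous_uncurry_besselClifford 2))

theorem continuous_coneIntegral {k : ℝ → ℝ → ℝ} (hk : Continuous (Function.uncurry k))
    {ψ : ℝ → ℝ} (hψ : Continuous ψ) (x : ℝ) :
    Continuous (coneIntegral k ψ x) :=
  continuous_integral_neg_self (continuous_coneIntegrand hk hψ x)

theorem hasDerivAt_coneIntegral {k k' : ℝ → ℝ → ℝ} (hk : Continuous (Function.uncurry k))
    (hk' : Continuous (Function.uncurry k'))
    (hd : ∀ t y : ℝ, HasDerivAt (fun t => k t ((t ^ 2 - y ^ 2) / 16))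
      (k' t ((t ^ 2 - y ^ 2) / 16)) t) {ψ : ℝ → ℝ} (hψ : Continuous ψ) (x t : ℝ) :
    HasDerivAt (coneIntegral k ψ x)
      (k t 0 * (ψ (x - t) + ψ (x + t)) + coneIntegral k' ψ x t) t := by
  have h := hasDerivAt_integral_neg_self (continuous_coneIntegrand hk hψ x)
    (continuous_coneIntegrand hk' hψ x) (fun t y => (hd t y).mul_const (ψ (x - y))) t
  convert! h using 1
  simp only [neg_sq, sub_self, zero_div, sub_neg_eq_add, coneIntegral]
  ring

/-- The continuously differentiable part of `2 e^{t/2} ∂ₜ S(t)ψ(x)`; what remains is the boundary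
contribution `ψ(x - t) + ψ(x + t)`. -/
noncomputable def smoothPart (ψ : ℝ → ℝ) (x t : ℝ) : ℝ :=
  coneIntegral (fun t v => t / 8 * besselClifford 1 v) ψ x t -
    coneIntegral (fun _ v => besselClifford 0 v) ψ x t / 2

theorem hasDerivAt_coneIntegral_zero {ψ : ℝ → ℝ} (hψ : Continuous ψ) (x t : ℝ) :
    HasDerivAt (coneIntegral (fun _ v => besselClifford 0 v) ψ x)
      (ψ (x - t) + ψ (x + t) + coneIntegral (fun t v => t / 8 * besselClifford 1 v) ψ x t) t := by
  convert! hasDerivAt_coneIntegral (continuous_uncurry_besselClifford 0)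
    continuous_uncurry_firstTimeKernel (fun t y => hasDerivAt_besselClifford_cone 0 t y) hψ x t
    using 1
  rw [besselClifford_zero_zero, one_mul]

theorem hasDerivAt_coneIntegral_one {ψ : ℝ → ℝ} (hψ : Continuous ψ) (x t : ℝ) :
    HasDerivAt (coneIntegral (fun t v => t / 8 * besselClifford 1 v) ψ x)
      (t / 8 * (ψ (x - t) + ψ (x + t)) + coneIntegral
        (fun t v => besselClifford 1 v / 8 + t ^ 2 / 64 * besselClifford 2 v) ψ x t) t := by
  convert! hasDerivAt_coneIntegral continuous_uncurry_firstTimeKernel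
    continuous_uncurry_firstTimeKernel_deriv (fun t y => ?_) hψ x t using 1
  · rw [besselClifford_one_zero, mul_one]
  · convert! ((hasDerivAt_id t).div_const 8).mul (hasDerivAt_besselClifford_cone 1 t y) using 1
    simp only [id]
    ring

theorem hasDerivAt_smoothPart {ψ : ℝ → ℝ} (hψ : Continuous ψ) (x t : ℝ) :
    HasDerivAt (smoothPart ψ x)
      (t / 8 * (ψ (x - t) + ψ (x + t)) + coneIntegral
        (fun t v => besselClifford 1 v / 8 + t ^ 2 / 64 * besselClifford 2 v) ψ x t -
        (ψ (x - t) + ψ (x + t) +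
          coneIntegral (fun t v => t / 8 * besselClifford 1 v) ψ x t) / 2) t :=
  (hasDerivAt_coneIntegral_one hψ x t).sub ((hasDerivAt_coneIntegral_zero hψ x t).div_const 2)

theorem contDiff_smoothPart {ψ : ℝ → ℝ} (hψ : Continuous ψ) (x : ℝ) :
    ContDiff ℝ 1 (smoothPart ψ x) := by
  refine contDiff_one_iff_deriv.2
    ⟨fun t => (hasDerivAt_smoothPart hψ x t).differentiableAt, ?_⟩
  rw [funext fun t => (hasDerivAt_smoothPart hψ x t).deriv]
  have h1 := continuous_coneIntegral continuous_uncurry_firstTimeKernel hψ x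
  have h2 := continuous_coneIntegral continuous_uncurry_firstTimeKernel_deriv hψ x
  fun_prop

theorem hasDerivAt_exp_neg_div_two (t : ℝ) :
    HasDerivAt (fun t : ℝ => Real.exp (-t / 2) / 2) (-(Real.exp (-t / 2) / 4)) t := by
  convert! (((hasDerivAt_id t).neg.div_const 2).exp).div_const 2 using 1
  simp only [Pi.neg_apply, id]
  ring

theorem hasDerivAt_dampedWaveS {φ ψ : ℝ → ℝ} (h : ∀ᵐ x, φ x = ψ x) (hψ : Continuous ψ)
    (x t : ℝ) : HasDerivAt (fun s => dampedWaveS s φ x)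
      (Real.exp (-t / 2) / 2 * ((ψ (x - t) + ψ (x + t)) + smoothPart ψ x t)) t := by
  have he : (fun s => dampedWaveS s φ x) = fun s => Real.exp (-s / 2) / 2 *
      coneIntegral (fun _ v => besselClifford 0 v) ψ x s :=
    funext fun s => dampedWaveS_eq h s x
  rw [he]
  convert! (hasDerivAt_exp_neg_div_two t).mul (hasDerivAt_coneIntegral_zero hψ x t) using 1
  rw [smoothPart]
  ring

theorem deriv_dampedWaveS {φ ψ : ℝ → ℝ} (h : ∀ᵐ x, φ x = ψ x) (hψ : Continuous ψ) (x : ℝ) :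
    deriv (fun s => dampedWaveS s φ x) = fun t =>
      Real.exp (-t / 2) / 2 * ((ψ (x - t) + ψ (x + t)) + smoothPart ψ x t) :=
  funext fun t => (hasDerivAt_dampedWaveS h hψ x t).deriv

theorem locallyLipschitz_deriv_dampedWaveS {φ ψ : ℝ → ℝ} (h : ∀ᵐ x, φ x = ψ x) {K : NNReal}
    (hψ : LipschitzWith K ψ) (x : ℝ) : LocallyLipschitz (deriv fun s => dampedWaveS s φ x) := by
  rw [deriv_dampedWaveS h hψ.continuous x]
  have hsm := contDiff_smoothPart hψ.continuous x
  have h1 : ContDiff ℝ 1 fun p : ℝ × ℝ × ℝ =>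
      Real.exp (-p.1 / 2) / 2 * ((p.2.1 + p.2.2) + smoothPart ψ x p.1) := by
    have h3 : ContDiff ℝ 1 fun p : ℝ × ℝ × ℝ => smoothPart ψ x p.1 :=
      hsm.comp (contDiff_fst : ContDiff ℝ 1 fun p : ℝ × ℝ × ℝ => p.1)
    fun_prop
  have h2 : LocallyLipschitz fun t : ℝ => (t, ψ (x - t), ψ (x + t)) := by
    refine LocallyLipschitz.id.prodMk (LocallyLipschitz.prodMk ?_ ?_)
    · exact hψ.locallyLipschitz.comp
        (g := fun t => x - t)
        (contDiff_const.sub contDiff_id : ContDiff ℝ 1 fun t : ℝ => x - t).locallyLipschitz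
    · exact hψ.locallyLipschitz.comp
        (g := fun t => x + t)
        (contDiff_const.add contDiff_id : ContDiff ℝ 1 fun t : ℝ => x + t).locallyLipschitz
  exact h1.locallyLipschitz.comp h2

theorem ae_differentiableAt_deriv_dampedWaveS {φ ψ : ℝ → ℝ} (h : ∀ᵐ x, φ x = ψ x) {K : NNReal}
    (hψ : LipschitzWith K ψ) (t : ℝ) :
    ∀ᵐ x, DifferentiableAt ℝ (deriv fun s => dampedWaveS s φ x) t := by
  have h0 := hψ.ae_differentiableAt_real
  have h1 : ∀ᵐ x, DifferentiableAt ℝ ψ (x - t) :=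
    (measurePreserving_sub_right volume t).quasiMeasurePreserving.ae h0
  have h2 : ∀ᵐ x, DifferentiableAt ℝ ψ (x + t) :=
    (measurePreserving_add_right volume t).quasiMeasurePreserving.ae h0
  filter_upwards [h1, h2] with x hx1 hx2
  rw [deriv_dampedWaveS h hψ.continuous x]
  have d1 : DifferentiableAt ℝ (fun s => ψ (x - s)) t :=
    DifferentiableAt.comp (g := ψ) (f := fun s => x - s) t hx1 (by fun_prop)
  have d2 : DifferentiableAt ℝ (fun s => ψ (x + s)) t :=
    DifferentiableAt.comp (g := ψ) (f := fun s => x + s) t hx2 (by fun_prop)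
  have d3 := (hasDerivAt_smoothPart hψ.continuous x t).differentiableAt
  fun_prop

/-- The second time derivative, wherever it exists, is the integral against the twice
differentiated kernel plus terms at the two ends of the light cone. -/
theorem exists_hasDerivAt_and_eq_of_hasDerivAt_deriv {φ ψ : ℝ → ℝ} (h : ∀ᵐ x, φ x = ψ x)
    (hψ : Continuous ψ) {x t d : ℝ} (hd : HasDerivAt (deriv fun s => dampedWaveS s φ x) d t) :
    ∃ p, HasDerivAt (fun s => ψ (x - s) + ψ (x + s)) p t ∧
      d = Real.exp (-t / 2) / 2 * (coneIntegral secondTimeKernel ψ x t +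
        (p + (t / 8 - 1) * (ψ (x - t) + ψ (x + t)))) := by
  rw [deriv_dampedWaveS h hψ x] at hd
  have hexp : HasDerivAt (fun t : ℝ => 2 * Real.exp (t / 2)) (Real.exp (t / 2)) t := by
    convert! (((hasDerivAt_id t).div_const 2).exp).const_mul 2 using 1
    simp only [id]
    ring
  have hinv : ∀ s : ℝ, 2 * Real.exp (s / 2) * (Real.exp (-s / 2) / 2) = 1 := fun s => by
    have : Real.exp (s / 2) * Real.exp (-s / 2) = 1 := by
      rw [← Real.exp_add, ← add_div, add_neg_cancel, zero_div, Real.exp_zero]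
    linarith
  have hP := (hexp.mul hd).sub (hasDerivAt_smoothPart hψ x t)
  have hfun : ((fun t : ℝ => 2 * Real.exp (t / 2)) * (fun t =>
      Real.exp (-t / 2) / 2 * ((ψ (x - t) + ψ (x + t)) + smoothPart ψ x t))) - smoothPart ψ x =
      fun s => ψ (x - s) + ψ (x + s) := by
    funext s
    simp only [Pi.sub_apply, Pi.mul_apply]
    rw [← mul_assoc, hinv, one_mul, add_sub_cancel_right]
  rw [hfun] at hP
  refine ⟨_, hP, ?_⟩
  have hii : ∀ {k : ℝ → ℝ → ℝ}, Continuous (Function.uncurry k) → IntervalIntegrable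
      (fun y => k t ((t ^ 2 - y ^ 2) / 16) * ψ (x - y)) volume (-t) t := fun hk =>
    (continuous_coneIntegrand_apply hk hψ x t).intervalIntegrable _ _
  have i0 := hii (continuous_uncurry_besselClifford 0)
  have i1 := hii continuous_uncurry_firstTimeKernel
  have i2 := hii continuous_uncurry_firstTimeKernel_deriv
  have hL : coneIntegral secondTimeKernel ψ x t =
      coneIntegral (fun _ v => besselClifford 0 v) ψ x t / 4 -
        coneIntegral (fun t v => t / 8 * besselClifford 1 v) ψ x t +
        coneIntegral (fun t v => besselClifford 1 v / 8 + t ^ 2 / 64 * besselClifford 2 v)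
          ψ x t := by
    simp only [coneIntegral]
    rw [← intervalIntegral.integral_div, ← intervalIntegral.integral_sub (i0.div_const 4) i1,
      ← intervalIntegral.integral_add ((i0.div_const 4).sub i1) i2]
    congr 1
    funext y
    simp only [secondTimeKernel]
    ring
  have hi := hinv t
  have hi' : Real.exp (t / 2) * (Real.exp (-t / 2) / 2) = 1 / 2 := by linarith
  rw [hL]
  set e₁ := Real.exp (t / 2)
  set e₂ := Real.exp (-t / 2) / 2
  rw [smoothPart]
  linear_combination (-d) * hi -
    e₂ * ((ψ (x - t) + ψ (x + t)) + (coneIntegral (fun t v => t / 8 * besselClifford 1 v) ψ x t -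
      coneIntegral (fun _ v => besselClifford 0 v) ψ x t / 2)) * hi'

/-! ### The decay estimate -/

theorem rpow_neg_four_mul_eq {t : ℝ} (ht : 0 < t) (σ : ℝ) :
    t ^ (-4 * (1 - σ)) = (t ^ σ) ^ 4 / t ^ 4 := by
  rw [show -4 * (1 - σ) = σ * (4 : ℕ) - (4 : ℕ) by push_cast; ring, Real.rpow_sub ht,
    Real.rpow_mul_natCast ht.le, Real.rpow_natCast]

theorem one_div_sq_le_rpow {t σ : ℝ} (ht : 1 ≤ t) (hσ : 1 / 2 ≤ σ) :
    1 / t ^ 2 ≤ t ^ (-4 * (1 - σ)) := by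
  have h : (1 : ℝ) / t ^ 2 = t ^ (-2 : ℝ) := by
    rw [Real.rpow_neg (by linarith), one_div]
    norm_cast
  rw [h]
  exact Real.rpow_le_rpow_of_exponent_le ht (by linarith)

/-- Inside `|y| ≤ t^σ / 2` the twice differentiated kernel is small compared with the wave kernel;
outside, it is at most `t²` times a stretched exponential. -/
theorem exp_mul_abs_secondTimeKernel_le {σ t y : ℝ} (hσ : σ ∈ Ioo (1 / 2 : ℝ) 1) (ht : 2 ≤ t)
    (hy : |y| ≤ t) :
    Real.exp (-t / 2) * |secondTimeKernel t ((t ^ 2 - y ^ 2) / 16)| ≤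
      8192 * t ^ (-4 * (1 - σ)) *
        (Real.exp (-t / 2) * besselClifford 0 ((t ^ 2 - y ^ 2) / 16)) +
      t ^ 2 * Real.exp (-(t ^ (2 * σ - 1) / 16)) := by
  have ht0 : 0 < t := by linarith
  have hy2 : y ^ 2 ≤ t ^ 2 := sq_le_sq' (abs_le.1 hy).1 (abs_le.1 hy).2
  have hB : 0 < besselClifford 0 ((t ^ 2 - y ^ 2) / 16) := besselClifford_pos 0 (by linarith)
  have he := Real.exp_pos (-t / 2)
  rcases le_or_gt |y| (t ^ σ / 2) with h | h
  · have hσt : t ^ σ ≤ t := by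
      conv_rhs => rw [← Real.rpow_one t]
      exact Real.rpow_le_rpow_of_exponent_le (by linarith) hσ.2.le
    have h1 := abs_secondTimeKernel_le_of_abs_le_half ht (h.trans (by linarith))
    have h2 := one_div_sq_le_rpow (t := t) (by linarith) hσ.1.le
    have h3 : (y ^ 2 / t ^ 2) ^ 2 ≤ t ^ (-4 * (1 - σ)) := by
      rw [rpow_neg_four_mul_eq ht0, div_pow, ← pow_mul, ← pow_mul]
      have hs : 0 ≤ t ^ σ := by positivity
      have : |y| ^ 4 ≤ (t ^ σ) ^ 4 := by
        gcongr
        linarith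
      rw [Even.pow_abs (by decide)] at this
      gcongr
    have h4 : 4096 * (1 / t ^ 2 + (y ^ 2 / t ^ 2) ^ 2) ≤ 8192 * t ^ (-4 * (1 - σ)) := by
      linarith
    have h5 := mul_le_mul_of_nonneg_left
      (h1.trans (mul_le_mul_of_nonneg_right h4 hB.le)) he.le
    have h6 : 0 ≤ t ^ 2 * Real.exp (-(t ^ (2 * σ - 1) / 16)) := by positivity
    linarith
  · have h1 := abs_secondTimeKernel_le ht (v := (t ^ 2 - y ^ 2) / 16) (by linarith)
    have h2 := exp_mul_besselClifford_le ht0 hy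
    have h3 : Real.exp (-(y ^ 2 / (4 * t))) ≤ Real.exp (-(t ^ (2 * σ - 1) / 16)) := by
      rw [Real.exp_le_exp, neg_le_neg_iff]
      have e1 : t ^ (2 * σ - 1) = (t ^ σ) ^ 2 / t := by
        rw [Real.rpow_sub_one ht0.ne', mul_comm, ← Nat.cast_two, Real.rpow_mul_natCast ht0.le]
      have e2 : (t ^ σ / 2) ^ 2 ≤ y ^ 2 := by
        rw [← sq_abs y]
        exact pow_le_pow_left₀ (by positivity) h.le 2
      rw [e1, div_div, div_le_div_iff₀ (by positivity) (by positivity)]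
      nlinarith
    have h4 : 0 ≤ 8192 * t ^ (-4 * (1 - σ)) *
        (Real.exp (-t / 2) * besselClifford 0 ((t ^ 2 - y ^ 2) / 16)) := by positivity
    calc _ ≤ Real.exp (-t / 2) * (t ^ 2 * besselClifford 0 ((t ^ 2 - y ^ 2) / 16)) := by gcongr
      _ = t ^ 2 * (Real.exp (-t / 2) * besselClifford 0 ((t ^ 2 - y ^ 2) / 16)) := by ring
      _ ≤ t ^ 2 * Real.exp (-(t ^ (2 * σ - 1) / 16)) := by
        gcongr
        exact h2.trans h3
      _ ≤ _ := by linarith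

namespace IsDoublingWeight

variable {ψ : ℝ → ℝ} {C : ℝ}

/-- The part of the wave kernel near the origin already bounds the solution from below. -/
theorem le_mul_coneIntegral (h : IsDoublingWeight ψ C) {t : ℝ} (ht : 2 ≤ t) (x : ℝ) :
    ψ x ≤ 8 * C * t * (Real.exp (-t / 2) / 2 *
      coneIntegral (fun _ v => besselClifford 0 v) ψ x t) := by
  have ht0 : 0 < t := by linarith
  have hC := h.one_le
  have hcont : Continuous fun y =>
      besselClifford 0 ((t ^ 2 - y ^ 2) / 16) * ψ (x - y) :=
    continuous_coneIntegrand_apply (continuous_uncurry_besselClifford 0) h.continuous x t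
  have h1 : ∫ y in (-(1 / 2) : ℝ)..(1 / 2), besselClifford 0 ((t ^ 2 - y ^ 2) / 16) * ψ (x - y) ≤
      coneIntegral (fun _ v => besselClifford 0 v) ψ x t := by
    refine intervalIntegral.integral_mono_interval (by linarith) (by norm_num) (by linarith) ?_
      (hcont.intervalIntegrable _ _)
    refine (ae_restrict_iff' measurableSet_Ioc).2 (Eventually.of_forall fun y hy => ?_)
    have hy2 : y ^ 2 ≤ t ^ 2 := sq_le_sq' hy.1.le hy.2
    exact mul_nonneg (besselClifford_pos 0 (by linarith)).le (h.pos _).le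
  have h2 : ∫ _ in (-(1 / 2) : ℝ)..(1 / 2), 1 / (4 * t) * (ψ x / C) ≤
      ∫ y in (-(1 / 2) : ℝ)..(1 / 2), Real.exp (-t / 2) *
        (besselClifford 0 ((t ^ 2 - y ^ 2) / 16) * ψ (x - y)) := by
    refine intervalIntegral.integral_mono_on (by norm_num) intervalIntegrable_const
      ((hcont.const_mul _).intervalIntegrable _ _) fun y hy => ?_
    have hy' : |y| ≤ 1 / 2 := abs_le.2 hy
    rw [← mul_assoc]
    have hψ : ψ x / C ≤ ψ (x - y) := by
      rw [div_le_iff₀ (by linarith), mul_comm]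
      refine h.le_of_near x (x - y) ?_
      rw [sub_sub_cancel_left, abs_neg]
      linarith
    have hx := h.pos x
    have hk := le_exp_mul_besselClifford ht hy'
    exact mul_le_mul hk hψ (by positivity) (hk.trans' (by positivity))
  rw [intervalIntegral.integral_const, intervalIntegral.integral_const_mul] at h2
  have h3 := mul_le_mul_of_nonneg_left h1 (Real.exp_pos (-t / 2)).le
  have h4 : 1 / (4 * t) * (ψ x / C) ≤
      Real.exp (-t / 2) * coneIntegral (fun _ v => besselClifford 0 v) ψ x t := by
    refine (h2.trans h3).trans' (le_of_eq ?_)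
    norm_num
  have h5 : ψ x = 4 * C * t * (1 / (4 * t) * (ψ x / C)) := by
    field_simp
  rw [h5]
  have := mul_le_mul_of_nonneg_left h4 (show 0 ≤ 4 * C * t by positivity)
  linarith

/-- A derivative of `s ↦ ψ(x - s) + ψ(x + s)` is controlled by the function itself. -/
theorem abs_deriv_le (h : IsDoublingWeight ψ C) {x t p : ℝ}
    (hp : HasDerivAt (fun s => ψ (x - s) + ψ (x + s)) p t) :
    |p| ≤ C ^ 2 * (ψ (x - t) + ψ (x + t)) := by
  have h1 := h.pos (x - t)
  have h2 := h.pos (x + t)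
  refine hp.le_of_lip' (by positivity) ?_
  filter_upwards [Metric.ball_mem_nhds t one_pos] with s hs
  rw [Metric.mem_ball, Real.dist_eq] at hs
  have e1 : |x - s - (x - t)| = |s - t| := by
    rw [show x - s - (x - t) = -(s - t) by ring, abs_neg]
  have e2 : |x + s - (x + t)| = |s - t| := by rw [show x + s - (x + t) = s - t by ring]
  have l1 := h.abs_sub_le (x - t) (x - s) (by rwa [e1])
  have l2 := h.abs_sub_le (x + t) (x + s) (by rwa [e2])
  rw [e1] at l1
  rw [e2] at l2
  rw [Real.norm_eq_abs, Real.norm_eq_abs, add_sub_add_comm]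
  refine (abs_add_le _ _).trans ?_
  linarith

theorem exp_mul_abs_coneIntegral_le (h : IsDoublingWeight ψ C) {A : ℝ} {p : ℕ}
    (hA : ∀ t x y : ℝ, 2 ≤ t → |y| ≤ t → ψ (x - y) ≤ A * t ^ p * ψ x) {σ t : ℝ}
    (hσ : σ ∈ Ioo (1 / 2 : ℝ) 1) (ht : 2 ≤ t) (x : ℝ) :
    Real.exp (-t / 2) * |coneIntegral secondTimeKernel ψ x t| ≤
      8192 * t ^ (-4 * (1 - σ)) *
        (Real.exp (-t / 2) * coneIntegral (fun _ v => besselClifford 0 v) ψ x t) +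
      2 * t * (t ^ 2 * Real.exp (-(t ^ (2 * σ - 1) / 16)) * (A * t ^ p * ψ x)) := by
  set E := Real.exp (-t / 2) with hE
  have hE0 : 0 < E := Real.exp_pos _
  set η := Real.exp (-(t ^ (2 * σ - 1) / 16)) with hη
  have hk : Continuous fun y => besselClifford 0 ((t ^ 2 - y ^ 2) / 16) * ψ (x - y) :=
    continuous_coneIntegrand_apply (continuous_uncurry_besselClifford 0) h.continuous x t
  have hb : Continuous fun y => 8192 * t ^ (-4 * (1 - σ)) *
      (E * (besselClifford 0 ((t ^ 2 - y ^ 2) / 16) * ψ (x - y))) :=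
    (hk.const_mul E).const_mul _
  have hpt : ∀ y, y ∈ Ioc (-t) t →
      ‖E * (secondTimeKernel t ((t ^ 2 - y ^ 2) / 16) * ψ (x - y))‖ ≤
      8192 * t ^ (-4 * (1 - σ)) *
        (E * (besselClifford 0 ((t ^ 2 - y ^ 2) / 16) * ψ (x - y))) +
      t ^ 2 * η * (A * t ^ p * ψ x) := fun y hy => by
    have hy' : |y| ≤ t := abs_le.2 ⟨hy.1.le, hy.2⟩
    have hψ := h.pos (x - y)
    have h1 := mul_le_mul_of_nonneg_right (exp_mul_abs_secondTimeKernel_le hσ ht hy') hψ.le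
    have h2 := mul_le_mul_of_nonneg_left (hA t x y ht hy')
      (show 0 ≤ t ^ 2 * η by positivity)
    rw [Real.norm_eq_abs, abs_mul, abs_mul, abs_of_pos hE0, abs_of_pos hψ]
    linarith
  have h1 := intervalIntegral.norm_integral_le_of_norm_le (a := -t) (b := t) (μ := volume)
    (by linarith) (Eventually.of_forall hpt)
    ((hb.intervalIntegrable _ _).add intervalIntegrable_const)
  rw [intervalIntegral.integral_const_mul, intervalIntegral.integral_add
    (hb.intervalIntegrable _ _) intervalIntegrable_const, intervalIntegral.integral_const_mul,
    intervalIntegral.integral_const_mul, intervalIntegral.integral_const, norm_mul,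
    Real.norm_of_nonneg hE0.le] at h1
  refine h1.trans (le_of_eq ?_)
  simp only [coneIntegral, smul_eq_mul]
  ring

/-- The decay estimate for the second time derivative, at every point where it exists. -/
theorem exists_abs_le_mul_dampedWaveS (h : IsDoublingWeight ψ C) {φ : ℝ → ℝ}
    (hφ : ∀ᵐ x, φ x = ψ x) {σ : ℝ} (hσ : σ ∈ Ioo (1 / 2 : ℝ) 1) :
    ∃ Cσ : ℝ, 0 < Cσ ∧ ∀ t : ℝ, 2 ≤ t → ∀ x d : ℝ,
      HasDerivAt (deriv (fun s : ℝ => dampedWaveS s φ x)) d t →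
        |d| ≤ Cσ * t ^ (-4 * (1 - σ)) * dampedWaveS t φ x := by
  obtain ⟨A, n, hA0, hA⟩ := h.exists_le_pow_mul
  -- six extra powers: three for the size of the error terms, two for the decay `t⁻²` and one for
  -- the comparison of `ψ` with the solution
  obtain ⟨M, hM0, hM⟩ := exists_pow_mul_exp_neg_rpow_le
    (show 0 < 2 * σ - 1 by linarith [hσ.1]) (n + 6)
  have hC := h.one_le
  refine ⟨8192 + (C ^ 2 + 2) * A * M * (8 * C), by positivity, fun t ht x d hd => ?_⟩
  have ht0 : 0 < t := by linarith
  obtain ⟨p, hp, rfl⟩ := exists_hasDerivAt_and_eq_of_hasDerivAt_deriv hφ h.continuous hd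
  have hS : dampedWaveS t φ x = Real.exp (-t / 2) / 2 *
      coneIntegral (fun _ v => besselClifford 0 v) ψ x t := dampedWaveS_eq hφ t x
  have h1 := h.exp_mul_abs_coneIntegral_le hA hσ ht x
  have h2 := h.abs_deriv_le hp
  have h3 := h.le_mul_coneIntegral ht x
  rw [← hS] at h3
  have hx := h.pos x
  set E := Real.exp (-t / 2) with hE
  have hE0 : 0 < E := Real.exp_pos _
  set η := Real.exp (-(t ^ (2 * σ - 1) / 16)) with hη
  have hη0 : 0 < η := Real.exp_pos _
  have hEη : E ≤ η := by
    rw [hE, hη, Real.exp_le_exp]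
    have : t ^ (2 * σ - 1) ≤ t := by
      conv_rhs => rw [← Real.rpow_one t]
      exact Real.rpow_le_rpow_of_exponent_le (by linarith) (by linarith [hσ.2])
    linarith
  have hp1 : ψ (x - t) ≤ A * t ^ n * ψ x := hA t x t ht (abs_of_pos ht0).le
  have hp2 : ψ (x + t) ≤ A * t ^ n * ψ x := by
    have := hA t x (-t) ht (by rw [abs_neg, abs_of_pos ht0])
    rwa [sub_neg_eq_add] at this
  have hP0 : 0 < ψ (x - t) + ψ (x + t) := add_pos (h.pos _) (h.pos _)
  set P := ψ (x - t) + ψ (x + t) with hPdef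
  set Q := A * t ^ n * ψ x with hQ
  have hQ0 : 0 < Q := by positivity
  have hPQ : P ≤ 2 * Q := by linarith
  have h4 : |p + (t / 8 - 1) * P| ≤ (C ^ 2 + 1) * t ^ 3 * P := by
    have e1 : |t / 8 - 1| ≤ t ^ 3 := by
      rw [abs_le]
      constructor <;> nlinarith [sq_nonneg t, pow_pos ht0 3]
    have e2 : |(t / 8 - 1) * P| ≤ t ^ 3 * P := by
      rw [abs_mul, abs_of_pos hP0]
      gcongr
    have e3 : (1 : ℝ) ≤ t ^ 3 := one_le_pow₀ (by linarith)
    have e4 : C ^ 2 * P ≤ C ^ 2 * P * t ^ 3 := le_mul_of_one_le_right (by positivity) e3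
    have e5 := (abs_add_le p ((t / 8 - 1) * P))
    linarith
  have h5 : E * |p + (t / 8 - 1) * P| ≤ η * ((C ^ 2 + 1) * t ^ 3 * (2 * Q)) := by
    refine mul_le_mul hEη (h4.trans ?_) (abs_nonneg _) hη0.le
    gcongr
  have h6 : |E / 2 * (coneIntegral secondTimeKernel ψ x t + (p + (t / 8 - 1) * P))| ≤
      8192 * t ^ (-4 * (1 - σ)) * dampedWaveS t φ x + (C ^ 2 + 2) * (t ^ 3 * η * Q) := by
    rw [abs_mul, abs_of_pos (half_pos hE0), hS]
    have := mul_le_mul_of_nonneg_left (abs_add_le (coneIntegral secondTimeKernel ψ x t)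
      (p + (t / 8 - 1) * P)) (half_pos hE0).le
    linarith
  have h7 : t ^ 3 * η * Q ≤ t ^ (-4 * (1 - σ)) * (A * M * (8 * C) * dampedWaveS t φ x) := by
    have e1 : t ^ n * t ^ 3 * η ≤ M * (1 / t ^ 3) := by
      rw [mul_one_div, le_div_iff₀ (by positivity)]
      refine (hM t (by linarith)).trans' (le_of_eq ?_)
      rw [← hη]
      ring
    have hS0 : 0 ≤ dampedWaveS t φ x :=
      (pos_of_mul_pos_right (hx.trans_le h3) (by positivity)).le
    calc t ^ 3 * η * Q = A * (t ^ n * t ^ 3 * η) * ψ x := by rw [hQ]; ring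
      _ ≤ A * (M * (1 / t ^ 3)) * (8 * C * t * dampedWaveS t φ x) := by gcongr
      _ = 1 / t ^ 2 * (A * M * (8 * C) * dampedWaveS t φ x) := by
        field_simp
      _ ≤ _ := by
        gcongr
        exact one_div_sq_le_rpow (by linarith) hσ.1.le
  calc _ ≤ _ := h6
    _ ≤ 8192 * t ^ (-4 * (1 - σ)) * dampedWaveS t φ x +
        (C ^ 2 + 2) * (t ^ (-4 * (1 - σ)) * (A * M * (8 * C) * dampedWaveS t φ x)) := by gcongr
    _ = _ := by ring

end IsDoublingWeight

theorem lemma3p3 (φ φ' : ℝ → ℝ)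
    -- `φ ∈ W^{1,1} ∩ W^{1,∞}(ℝ; (0,∞))` with weak derivative `φ'`; as an element of a Sobolev
    -- space, `φ` matters only up to null sets, so all infima below are essential infima
    (hφ : MemW11W1Infty φ φ')
    (hpos : ∀ᵐ x : ℝ, 0 < φ x)
    (hIC : ∃ C : ℝ,
      (∀ᵐ x : ℝ, ∀ᵐ y : ℝ, y ∈ Ioo (x - 1) (x + 1) → φ x ≤ C * φ y) ∧
      (∀ᵐ x : ℝ, ∀ᵐ y : ℝ, |y| < 2 * |x| → φ x ≤ C * φ y) ∧
      (∀ᵐ x : ℝ, |φ' x| ≤ C * φ x))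
    (hexp : ∀ δ : ℝ, 0 < δ → ∃ Cδ : ℝ, 0 < Cδ ∧
      ∀ᵐ x : ℝ, Real.exp (-δ * |x|) ≤ Cδ * φ x) :
    -- `∂ₜ S(t)φ(x)` exists at every `t > 0` and every `x`
    (∀ x t : ℝ, 0 < t → DifferentiableAt ℝ (fun s : ℝ => dampedWaveS s φ x) t) ∧
    -- for every `x` it is locally Lipschitz in `t > 0`, so that its a.e. derivative in `t` is
    -- also its weak derivative
    (∀ x : ℝ, LocallyLipschitzOn (Ioi (0 : ℝ)) (deriv (fun s : ℝ => dampedWaveS s φ x))) ∧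
    -- for every `t > 0`, `∂ₜ² S(t)φ(x)` exists for almost every `x`
    (∀ t : ℝ, 0 < t → ∀ᵐ x : ℝ,
      DifferentiableAt ℝ (deriv (fun s : ℝ => dampedWaveS s φ x)) t) ∧
    -- the estimate, at every point at which `∂ₜ² S(t)φ(x)` exists
    (∀ σ : ℝ, σ ∈ Ioo (1 / 2 : ℝ) 1 → ∃ Cσ : ℝ, 0 < Cσ ∧
      ∀ t : ℝ, 2 ≤ t → ∀ x d : ℝ,
        HasDerivAt (deriv (fun s : ℝ => dampedWaveS s φ x)) d t →
          |d| ≤ Cσ * t ^ (-4 * (1 - σ)) * dampedWaveS t φ x) := by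
  obtain ⟨ψ, K, hlip, hφψ, hsub⟩ := hφ.exists_lipschitzWith
  obtain ⟨C, h1, h2, h3⟩ := hIC
  have hw : IsDoublingWeight ψ C :=
    isDoublingWeight_of_ae hlip.continuous hφψ hsub (hexp 1 one_pos) h1 h2 h3
  exact ⟨fun x t _ => (hasDerivAt_dampedWaveS hφψ hlip.continuous x t).differentiableAt,
    fun x => (locallyLipschitz_deriv_dampedWaveS hφψ hlip x).locallyLipschitzOn,
    fun t _ => ae_differentiableAt_deriv_dampedWaveS hφψ hlip t,
    fun σ hσ => hw.exists_abs_le_mul_dampedWaveS hφψ hσ⟩
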